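/- **Setting.** Let $n_1=n\ge1$, $n_2=m\ge 1$, and for $i=1,2$ let $A_i$ be an expansive dilation on $\mathbb R^{n_i}$ (a real matrix all of whose complex eigenvalues have modulus $>1$); put $b_i=|\det A_i|$. Fix an open ellipsoid $\Delta_i$ centred at $0$ with $|\Delta_i|=1$ and $\Delta_i\subset r\Delta_i\subset A_i\Delta_i$ for some $r>1$, and set $B^{(i)}_k=A_i^k\Delta_i$ for $k\in\mathbb Z$. *Dyadic cubes.* Fix integers $v_i<0<u_i$. A dyadic grid $\mathcal Q^{(i)}=\bigcup_{k\in\mathbb Z}\mathcal Q^{(i)}_k$ consists of open subsets of $\mathbb R^{n_i}$ (the cubes of level $k$ being the members of $\mathcal Q^{(i)}_k$) such that: for each $k$ distinct cubes of level $k$ are disjoint and their union has a complement of measure zero; if $k\le l$, $Q\in\mathcal Q^{(i)}_k$, $Q'\in\mathcal Q^{(i)}_l$, then $Q\cap Q'=\emptyset$ or $Q'\subset Q$; if $k<l$, every $Q'\in\mathcal Q^{(i)}_l$ is contained in a unique $Q\in\mathcal Q^{(i)}_k$; and every $Q\in\mathcal Q^{(i)}_k$ contains a point $x_Q$ with $x_Q+B^{(i)}_{v_ik-u_i}\subset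 Q$ and $Q\subset x+B^{(i)}_{v_ik+u_i}$ for all $x\in Q$. A dyadic rectangle is a set $R=R_1\times R_2$ with $R_i\in\mathcal Q^{(i)}$. *Weights.* For $1<p<\infty$ and a measurable $w\ge0$ on $\mathbb R^{n_i}$, let $$C_{p,A_i}(w)=\sup_{x\in\mathbb R^{n_i},\,k\in\mathbb Z}\Big(\frac1{|B^{(i)}_k|}\int_{x+B^{(i)}_k}w\Big)\Big(\frac1{|B^{(i)}_k|}\int_{x+B^{(i)}_k}w^{-1/(p-1)}\Big)^{p-1},$$ and $w\in\mathcal A_p(A_i)$ if $w$ is not a.e. zero and $C_{p,A_i}(w)<\infty$. A measurable $w\ge0$ on $\mathbb R^n\times\mathbb R^m$ is in $\mathcal A_p(\vec A)$, $\vec A=(A_1,A_2)$, if $w(x_1,\cdot)\in\mathcal A_p(A_2)$ for a.e. $x_1$, $w(\cdot,x_2)\in\mathcal A_p(A_1)$ for a.e. $x_2$, and $$C_{p,\vec A}(w)=\max\Big\{\operatorname*{ess\,sup}_{x_1}C_{p,A_2}(w(x_1,\cdot)),\ \operatorname*{ess\,sup}_{x_2}C_{p,A_1}(w(\cdot,x_2))\Big\}<\infty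 .$$ Let $\mathcal A_\infty(\vec A)=\bigcup_{1<p<\infty}\mathcal A_p(\vec A)$, $q_w=\inf\{q\in(1,\infty):w\in\mathcal A_q(\vec A)\}$ and $w(E)=\int_Ew(x)\,dx$. *Maximal rectangles.* For an open set $\Omega\subset\mathbb R^n\times\mathbb R^m$ let $m_1(\Omega)$ (resp. $m_2(\Omega)$) be the family of all dyadic rectangles $R_1\times R_2\subset\Omega$ such that no dyadic cube $S\supsetneq R_1$ satisfies $S\times R_2\subset\Omega$ (resp. no dyadic cube $S\supsetneq R_2$ satisfies $R_1\times S\subset\Omega$). Let $\eta_0\in(0,1)$. For $R_1\times R_2\in m_1(\Omega)$ let $\widehat R_2$ be the largest dyadic cube containing $R_2$ with $|(R_1\times\widehat R_2)\cap\Omega|>\eta_0|R_1\times\widehat R_2|$; for $R_1\times R_2\in m_2(\Omega)$ let $\widehat R_1$ be the largest dyadic cube containing $R_1$ with $|(\widehat R_1\times R_2)\cap\Omega|>\eta_0|\widehat R_1\times R_2|$. *The function $h$.* Let $h:[0,\infty)\to[0,\infty)$ be increasing (in the weak sense) with $\sum_{j=0}^\infty j\,h(C_0\delta_0^j)<\infty$,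 where $C_0=\max\{b_1^{2u_1-1},b_2^{2u_2-1}\}$ and $\delta_0=\max\{b_1^{v_1},b_2^{v_2}\}$. **Lemma 4.4.** Let $n,m,A_i,\Delta_i,u_i,v_i,\eta_0,h$ be as above, and let $q\in\mathbb R$ and $K\in[0,\infty)$. There is a constant $C>0$, depending only on these data, such that for all dyadic grids $\mathcal Q^{(1)},\mathcal Q^{(2)}$ with the parameters $(u_i,v_i)$, all $w\in\mathcal A_\infty(\vec A)$ with $q\in(q_w,\infty)$ and $C_{q,\vec A}(w)\le K$, and all open $\Omega\subset\mathbb R^n\times\mathbb R^m$ with $w(\Omega)<\infty$, the cubes $\widehat R_2$ (for all $R\in m_1(\Omega)$) and $\widehat R_1$ (for all $R\in m_2(\Omega)$) exist, and $$\sum_{R=R_1\times R_2\in m_1(\Omega)}w(R)\,h\Big(\frac{|R_2|}{|\widehat R_2|}\Big)\le C\,w(\Omega),\qquad \sum_{R=R_1\times R_2\in m_2(\Omega)}w(R)\,h\Big(\frac{|R_1|}{|\widehat R_1|}\Big)\le C\,w(\Omega).$$ -/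

import Mathlib

open MeasureTheory Set
open scoped ENNReal NNReal Pointwise

noncomputable section

/-- `A` is an expansive dilation: every complex eigenvalue of `A` has modulus greater than `1`. -/
def IsExpansiveDilation {n : ℕ} (A : Matrix (Fin n) (Fin n) ℝ) : Prop :=
  ∀ z ∈ spectrum ℂ (A.map Complex.ofReal), 1 < ‖z‖

/-- `b = |det A|`. -/
def dilationFactor {n : ℕ} (A : Matrix (Fin n) (Fin n) ℝ) : ℝ≥0 := ‖A.det‖₊

/-- `Δ` is an open ellipsoid centred at the origin (the image of the open unit ball under an
invertible linear map, hence open, convex and symmetric) of Lebesgue measure one, such that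
`Δ ⊆ r Δ ⊆ A Δ` for some `r > 1`. -/
structure IsUnitEllipsoid {n : ℕ} (A : Matrix (Fin n) (Fin n) ℝ)
    (Δ : Set (EuclideanSpace ℝ (Fin n))) : Prop where
  ellipsoid : ∃ P : EuclideanSpace ℝ (Fin n) ≃L[ℝ] EuclideanSpace ℝ (Fin n),
    Δ = P '' Metric.ball 0 1
  volume_eq_one : volume Δ = 1
  expanded : ∃ r : ℝ, 1 < r ∧ Δ ⊆ r • Δ ∧ r • Δ ⊆ Matrix.toEuclideanLin A '' Δ

/-- The dilated ball `x + B_k`, where `B_k = A ^ k Δ` and `k` is an integer. -/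
def dilatedBall {n : ℕ} (A : Matrix (Fin n) (Fin n) ℝ) (Δ : Set (EuclideanSpace ℝ (Fin n)))
    (x : EuclideanSpace ℝ (Fin n)) (k : ℤ) : Set (EuclideanSpace ℝ (Fin n)) :=
  (fun y => x + y) '' (Matrix.toEuclideanLin (A ^ k) '' Δ)

/-- A system of (Christ) dyadic cubes adapted to the dilation `A`, with parameters `v < 0 < u`:
`Q k` is the collection of all cubes of level `k`. -/
structure IsDyadicGrid {n : ℕ} (A : Matrix (Fin n) (Fin n) ℝ)
    (Δ : Set (EuclideanSpace ℝ (Fin n))) (v : ℤ) (u : ℕ)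
    (Q : ℤ → Set (Set (EuclideanSpace ℝ (Fin n)))) : Prop where
  isOpen : ∀ k, ∀ S ∈ Q k, IsOpen S
  covers : ∀ k, volume (⋃₀ Q k)ᶜ = 0
  disjoint : ∀ k, ∀ S ∈ Q k, ∀ T ∈ Q k, S ≠ T → Disjoint S T
  nested : ∀ k l, k ≤ l → ∀ S ∈ Q k, ∀ T ∈ Q l, Disjoint S T ∨ T ⊆ S
  parent : ∀ k l, k < l → ∀ T ∈ Q l, ∃! S, S ∈ Q k ∧ T ⊆ S
  balls : ∀ k, ∀ S ∈ Q k, ∃ c ∈ S, dilatedBall A Δ c (v * k - u) ⊆ S ∧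
    ∀ x ∈ S, S ⊆ dilatedBall A Δ x (v * k + u)

/-- The collection of the dyadic cubes of all levels. -/
def dyadicCubes {n : ℕ} (Q : ℤ → Set (Set (EuclideanSpace ℝ (Fin n)))) :
    Set (Set (EuclideanSpace ℝ (Fin n))) := ⋃ k, Q k

/-- The Muckenhoupt constant `C_{p,A,n}(w)` for `1 < p < ∞`, that is, the least `C` (possibly `∞`)
with `(avg_B w) (avg_B w^{-1/(p-1)})^{p-1} ≤ C` for all dilated balls `B`. -/
def muckenhouptConst {n : ℕ} (A : Matrix (Fin n) (Fin n) ℝ)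
    (Δ : Set (EuclideanSpace ℝ (Fin n))) (p : ℝ) (w : EuclideanSpace ℝ (Fin n) → ℝ) : ℝ≥0∞ :=
  ⨆ (x : EuclideanSpace ℝ (Fin n)) (k : ℤ),
    (⨍⁻ y in dilatedBall A Δ x k, ENNReal.ofReal (w y) ∂volume) *
      (⨍⁻ y in dilatedBall A Δ x k, ENNReal.ofReal (w y) ^ (-1 / (p - 1)) ∂volume) ^ (p - 1)

/-- The Muckenhoupt class `𝒜_p(A)` on `ℝⁿ`, for `1 < p < ∞`. The weight that vanishes almost
everywhere is excluded, since `0 * ∞ = 0` would otherwise admit it. -/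
structure IsMuckenhoupt {n : ℕ} (A : Matrix (Fin n) (Fin n) ℝ)
    (Δ : Set (EuclideanSpace ℝ (Fin n))) (p : ℝ) (w : EuclideanSpace ℝ (Fin n) → ℝ) : Prop where
  nonneg : ∀ x, 0 ≤ w x
  aemeasurable : AEMeasurable w volume
  nontrivial : ¬ w =ᵐ[volume] 0
  const_lt_top : muckenhouptConst A Δ p w < ∞

/-- The product Muckenhoupt constant `C_{p,(A₁,A₂),n,m}(w)`. -/
def productMuckenhouptConst {n m : ℕ}
    (A₁ : Matrix (Fin n) (Fin n) ℝ) (Δ₁ : Set (EuclideanSpace ℝ (Fin n)))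
    (A₂ : Matrix (Fin m) (Fin m) ℝ) (Δ₂ : Set (EuclideanSpace ℝ (Fin m)))
    (p : ℝ) (w : EuclideanSpace ℝ (Fin n) × EuclideanSpace ℝ (Fin m) → ℝ) : ℝ≥0∞ :=
  max (essSup (fun x₁ => muckenhouptConst A₂ Δ₂ p (fun x₂ => w (x₁, x₂))) volume)
    (essSup (fun x₂ => muckenhouptConst A₁ Δ₁ p (fun x₁ => w (x₁, x₂))) volume)

/-- The product Muckenhoupt class `𝒜_p(A₁, A₂)` on `ℝⁿ × ℝᵐ`, for `1 < p < ∞`. -/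
structure IsProductMuckenhoupt {n m : ℕ}
    (A₁ : Matrix (Fin n) (Fin n) ℝ) (Δ₁ : Set (EuclideanSpace ℝ (Fin n)))
    (A₂ : Matrix (Fin m) (Fin m) ℝ) (Δ₂ : Set (EuclideanSpace ℝ (Fin m)))
    (p : ℝ) (w : EuclideanSpace ℝ (Fin n) × EuclideanSpace ℝ (Fin m) → ℝ) : Prop where
  nonneg : ∀ x, 0 ≤ w x
  aemeasurable : AEMeasurable w volume
  slice₁ : ∀ᵐ x₁, IsMuckenhoupt A₂ Δ₂ p (fun x₂ => w (x₁, x₂))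
  slice₂ : ∀ᵐ x₂, IsMuckenhoupt A₁ Δ₁ p (fun x₁ => w (x₁, x₂))
  const_lt_top : productMuckenhouptConst A₁ Δ₁ A₂ Δ₂ p w < ∞

/-- `𝒜_∞(A₁, A₂)`, the union of the classes `𝒜_p(A₁, A₂)` over `1 < p < ∞`. -/
def IsProductMuckenhouptInfty {n m : ℕ}
    (A₁ : Matrix (Fin n) (Fin n) ℝ) (Δ₁ : Set (EuclideanSpace ℝ (Fin n)))
    (A₂ : Matrix (Fin m) (Fin m) ℝ) (Δ₂ : Set (EuclideanSpace ℝ (Fin m)))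
    (w : EuclideanSpace ℝ (Fin n) × EuclideanSpace ℝ (Fin m) → ℝ) : Prop :=
  ∃ p : ℝ, 1 < p ∧ IsProductMuckenhoupt A₁ Δ₁ A₂ Δ₂ p w

/-- The critical index `q_w = inf {q ∈ (1, ∞) : w ∈ 𝒜_q(A₁, A₂)}`. -/
def criticalIndex {n m : ℕ}
    (A₁ : Matrix (Fin n) (Fin n) ℝ) (Δ₁ : Set (EuclideanSpace ℝ (Fin n)))
    (A₂ : Matrix (Fin m) (Fin m) ℝ) (Δ₂ : Set (EuclideanSpace ℝ (Fin m)))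
    (w : EuclideanSpace ℝ (Fin n) × EuclideanSpace ℝ (Fin m) → ℝ) : ℝ :=
  sInf {q : ℝ | 1 < q ∧ IsProductMuckenhoupt A₁ Δ₁ A₂ Δ₂ q w}

/-- `w(E) = ∫_E w`. -/
def weightOf {n m : ℕ} (w : EuclideanSpace ℝ (Fin n) × EuclideanSpace ℝ (Fin m) → ℝ)
    (E : Set (EuclideanSpace ℝ (Fin n) × EuclideanSpace ℝ (Fin m))) : ℝ≥0∞ :=
  ∫⁻ x in E, ENNReal.ofReal (w x)

/-- `m₁(Ω)`: the dyadic rectangles `R = R₁ × R₂ ⊆ Ω`, given by their pair of sides, that are maximal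
in the direction of the first factor. -/
def maximalRects₁ {n m : ℕ} (Q₁ : ℤ → Set (Set (EuclideanSpace ℝ (Fin n))))
    (Q₂ : ℤ → Set (Set (EuclideanSpace ℝ (Fin m))))
    (Ω : Set (EuclideanSpace ℝ (Fin n) × EuclideanSpace ℝ (Fin m))) :
    Set (Set (EuclideanSpace ℝ (Fin n)) × Set (EuclideanSpace ℝ (Fin m))) :=
  {R | R.1 ∈ dyadicCubes Q₁ ∧ R.2 ∈ dyadicCubes Q₂ ∧ R.1 ×ˢ R.2 ⊆ Ω ∧
    ∀ S ∈ dyadicCubes Q₁, R.1 ⊆ S → S ×ˢ R.2 ⊆ Ω → S = R.1}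

/-- `m₂(Ω)`: the dyadic rectangles `R = R₁ × R₂ ⊆ Ω`, given by their pair of sides, that are maximal
in the direction of the second factor. -/
def maximalRects₂ {n m : ℕ} (Q₁ : ℤ → Set (Set (EuclideanSpace ℝ (Fin n))))
    (Q₂ : ℤ → Set (Set (EuclideanSpace ℝ (Fin m))))
    (Ω : Set (EuclideanSpace ℝ (Fin n) × EuclideanSpace ℝ (Fin m))) :
    Set (Set (EuclideanSpace ℝ (Fin n)) × Set (EuclideanSpace ℝ (Fin m))) :=
  {R | R.1 ∈ dyadicCubes Q₁ ∧ R.2 ∈ dyadicCubes Q₂ ∧ R.1 ×ˢ R.2 ⊆ Ω ∧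
    ∀ S ∈ dyadicCubes Q₂, R.2 ⊆ S → R.1 ×ˢ S ⊆ Ω → S = R.2}

/-- The dyadic cubes `S ⊇ R₂` with `|(R₁ × S) ∩ Ω| > η |R₁ × S|`. They form a chain. -/
def enlargements₂ {n m : ℕ} (Q₂ : ℤ → Set (Set (EuclideanSpace ℝ (Fin m)))) (η : ℝ)
    (Ω : Set (EuclideanSpace ℝ (Fin n) × EuclideanSpace ℝ (Fin m)))
    (R : Set (EuclideanSpace ℝ (Fin n)) × Set (EuclideanSpace ℝ (Fin m))) :
    Set (Set (EuclideanSpace ℝ (Fin m))) :=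
  {S | S ∈ dyadicCubes Q₂ ∧ R.2 ⊆ S ∧
    ENNReal.ofReal η * volume (R.1 ×ˢ S) < volume ((R.1 ×ˢ S) ∩ Ω)}

/-- The dyadic cubes `S ⊇ R₁` with `|(S × R₂) ∩ Ω| > η |S × R₂|`. They form a chain. -/
def enlargements₁ {n m : ℕ} (Q₁ : ℤ → Set (Set (EuclideanSpace ℝ (Fin n)))) (η : ℝ)
    (Ω : Set (EuclideanSpace ℝ (Fin n) × EuclideanSpace ℝ (Fin m)))
    (R : Set (EuclideanSpace ℝ (Fin n)) × Set (EuclideanSpace ℝ (Fin m))) :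
    Set (Set (EuclideanSpace ℝ (Fin n))) :=
  {S | S ∈ dyadicCubes Q₁ ∧ R.1 ⊆ S ∧
    ENNReal.ofReal η * volume (S ×ˢ R.2) < volume ((S ×ˢ R.2) ∩ Ω)}

/-- The longest member `R̂` of a chain of cubes, written as the union of the chain. -/
def longest {n : ℕ} (F : Set (Set (EuclideanSpace ℝ (Fin n)))) :
    Set (EuclideanSpace ℝ (Fin n)) := ⋃₀ F

/-- `longest F` is the longest member of `F` as soon as there is one. -/
theorem longest_eq_of_isGreatest {n : ℕ} {F : Set (Set (EuclideanSpace ℝ (Fin n)))}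
    {S : Set (EuclideanSpace ℝ (Fin n))} (h : IsGreatest F S) : longest F = S :=
  Subset.antisymm (sUnion_subset fun _ hT => h.2 hT) (subset_sUnion_of_mem h.1)

/-- `|S| / |T|`. -/
def volumeRatio {n : ℕ} (S T : Set (EuclideanSpace ℝ (Fin n))) : ℝ≥0 :=
  (volume S / volume T).toNNReal

end

/-! ### Volumes and exhaustion of dilated balls; chains of dyadic cubes. -/

section Geometry

variable {n : ℕ} {A : Matrix (Fin n) (Fin n) ℝ} {Δ : Set (EuclideanSpace ℝ (Fin n))}

/-! Everything rests on one consequence of the Muckenhoupt condition, `HasMassBound`: a subset that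
fills a fixed proportion of a dyadic cube carries a fixed proportion of its weight. No maximal
function is needed.

Existence of the largest enlargement. The mass bound forces the weight of the ancestors of a cube to
tend to infinity (`IsDyadicGrid.tendsto_lintegral_ancestors`). So a set of finite weight has density
tending to zero along them. Applied to almost every slice of `Ω` and integrated by dominated
convergence, this lets only finitely many ancestors have large density.

The sum. Let the largest enlargement of `R₂` be its `k`-th ancestor, and let `J` be the next one,
which fails the density test. Let `E` be the union of the cubes `S` with `S × J ⊆ Ω`. Since `E × J ⊆
Ω`, the set `E` fills at most the proportion `η` of `R₁`, so by the mass bound in the first variable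
`w(R)` is at most a constant times `w((R₁ \ E) × R₂)`. For fixed `j = k + 1` these smaller sets
overlap at most `j` times (`sum_indicator_diff_dyadicBase_le`). At a given point, the level of `R₂`
determines `R₂`, and maximality then determines `R₁`. Two such levels differ by less than `j`, since
otherwise the `J` of one rectangle would lie inside the second side of the other, and the point
would lie in the removed set `E`. As the volume ratio decays geometrically in `k`, summing over `j`
leaves the series `∑ j h(C₀ δ₀ ^ (j - 2))`, with natural subtraction. The second inequality follows
by exchanging the factors. -/

theorem volume_toEuclideanLin_image (A : Matrix (Fin n) (Fin n) ℝ)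
    (S : Set (EuclideanSpace ℝ (Fin n))) :
    volume (Matrix.toEuclideanLin A '' S) = (dilationFactor A : ℝ≥0∞) * volume S := by
  rw [Measure.addHaar_image_linearMap, LinearMap.det_toLpLin, ← Real.norm_eq_abs,
    ofReal_norm]
  rfl

/-- Comparing volumes in `r • Δ ⊆ A Δ` gives `r ^ n ≤ |det A|`; positive dimension makes this
strict. -/
theorem IsUnitEllipsoid.one_lt_dilationFactor (hΔ : IsUnitEllipsoid A Δ) (hn : 1 ≤ n) :
    1 < dilationFactor A := by
  obtain ⟨r, hr, -, h⟩ := hΔ.expanded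
  have h1 := measure_mono (μ := volume) h
  rw [volume_toEuclideanLin_image, Measure.addHaar_smul, hΔ.volume_eq_one, mul_one, mul_one,
    finrank_euclideanSpace_fin, ← Real.norm_eq_abs, ofReal_norm, enorm_le_coe] at h1
  refine lt_of_lt_of_le ?_ h1
  rw [← NNReal.coe_lt_coe, coe_nnnorm, norm_pow, Real.norm_of_nonneg (by linarith)]
  exact one_lt_pow₀ hr (by omega)

theorem det_ne_zero_of_one_lt (hb : 1 < dilationFactor A) : IsUnit A.det := by
  rw [isUnit_iff_ne_zero]
  intro h
  simp [dilationFactor, h] at hb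

theorem dilationFactor_zpow (A : Matrix (Fin n) (Fin n) ℝ) (k : ℤ) :
    dilationFactor (A ^ k) = dilationFactor A ^ k := by
  cases k with
  | ofNat k => simp [dilationFactor]
  | negSucc k =>
    simp [dilationFactor, zpow_negSucc, Matrix.det_nonsing_inv]

theorem IsUnitEllipsoid.volume_dilatedBall (hΔ : IsUnitEllipsoid A Δ)
    (x : EuclideanSpace ℝ (Fin n)) (k : ℤ) :
    volume (dilatedBall A Δ x k) = (dilationFactor A ^ k : ℝ≥0) := by
  rw [dilatedBall, image_add_left, measure_preimage_add, volume_toEuclideanLin_image,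
    hΔ.volume_eq_one, mul_one, dilationFactor_zpow]

theorem IsUnitEllipsoid.isOpen (hΔ : IsUnitEllipsoid A Δ) : IsOpen Δ := by
  obtain ⟨P, rfl⟩ := hΔ.ellipsoid
  exact P.isOpenMap _ Metric.isOpen_ball

theorem IsUnitEllipsoid.zero_mem (hΔ : IsUnitEllipsoid A Δ) : (0 : EuclideanSpace ℝ (Fin n)) ∈ Δ := by
  obtain ⟨P, rfl⟩ := hΔ.ellipsoid
  exact ⟨0, by simp, by simp⟩

theorem toEuclideanLin_surjective {B : Matrix (Fin n) (Fin n) ℝ} (hB : IsUnit B.det) :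
    Function.Surjective (Matrix.toEuclideanLin B) := by
  intro y
  refine ⟨Matrix.toEuclideanLin B⁻¹ y, ?_⟩
  have := Matrix.toLpLin_mul_same 2 B B⁻¹
  rw [Matrix.mul_nonsing_inv _ hB, Matrix.toLpLin_one] at this
  exact (LinearMap.congr_fun this y).symm

theorem IsUnitEllipsoid.isOpen_dilatedBall (hΔ : IsUnitEllipsoid A Δ) (hb : 1 < dilationFactor A)
    (x : EuclideanSpace ℝ (Fin n)) (k : ℤ) : IsOpen (dilatedBall A Δ x k) := by
  refine (Homeomorph.addLeft x).isOpenMap _ ?_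
  refine LinearMap.isOpenMap_of_finiteDimensional _ (toEuclideanLin_surjective ?_) _ hΔ.isOpen
  exact (det_ne_zero_of_one_lt hb).det_zpow k

theorem IsUnitEllipsoid.mem_dilatedBall (hΔ : IsUnitEllipsoid A Δ)
    (x : EuclideanSpace ℝ (Fin n)) (k : ℤ) : x ∈ dilatedBall A Δ x k :=
  ⟨0, ⟨0, hΔ.zero_mem, by simp⟩, by simp⟩

/-- Iterating `r • Δ ⊆ A Δ` gives `r ^ k • Δ ⊆ A ^ k Δ`, and the sets on the left exhaust the space
because `r > 1` and `Δ` is a neighbourhood of zero. -/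
theorem IsUnitEllipsoid.iUnion_dilatedBall (hΔ : IsUnitEllipsoid A Δ)
    (x : EuclideanSpace ℝ (Fin n)) : ⋃ k : ℕ, dilatedBall A Δ x k = univ := by
  obtain ⟨r, hr, -, h⟩ := hΔ.expanded
  have key : ∀ k : ℕ, ∀ y ∈ Δ, r ^ k • y ∈ Matrix.toEuclideanLin (A ^ k) '' Δ := by
    intro k
    induction k with
    | zero =>
      intro y hy
      exact ⟨y, hy, by simp⟩
    | succ k ih =>
      intro y hy
      obtain ⟨z, hz, hz'⟩ := ih y hy
      obtain ⟨t, ht, ht'⟩ := h (smul_mem_smul_set hz)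
      refine ⟨t, ht, ?_⟩
      rw [pow_succ A, Matrix.toEuclideanLin, Matrix.toLpLin_mul_same, LinearMap.comp_apply]
      rw [Matrix.toEuclideanLin] at ht' hz'
      rw [ht', map_smul, hz', smul_smul, pow_succ']
  rw [eq_univ_iff_forall]
  intro y
  have hlim : Filter.Tendsto (fun k : ℕ => (r⁻¹ ^ k) • (y - x)) Filter.atTop (nhds 0) := by
    have := (tendsto_pow_atTop_nhds_zero_of_lt_one (inv_nonneg.2 (by linarith : (0 : ℝ) ≤ r))
      (inv_lt_one_of_one_lt₀ hr)).smul_const (y - x)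
    simpa using this
  obtain ⟨k, hk⟩ := (hlim.eventually (hΔ.isOpen.mem_nhds hΔ.zero_mem)).exists
  refine mem_iUnion.2 ⟨k, y - x, ?_, by simp⟩
  have := key k _ hk
  rw [smul_smul, ← mul_pow, mul_inv_cancel₀ (by linarith : r ≠ 0), one_pow, one_smul] at this
  rwa [zpow_natCast]

variable {v : ℤ} {u : ℕ} {Q : ℤ → Set (Set (EuclideanSpace ℝ (Fin n)))}

theorem IsDyadicGrid.nonempty (hQ : IsDyadicGrid A Δ v u Q) {k : ℤ}
    {S : Set (EuclideanSpace ℝ (Fin n))} (hS : S ∈ Q k) : S.Nonempty := by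
  obtain ⟨c, hc, -⟩ := hQ.balls k S hS
  exact ⟨c, hc⟩

theorem IsDyadicGrid.exists_subset_dilatedBall (hQ : IsDyadicGrid A Δ v u Q) {k : ℤ}
    {S : Set (EuclideanSpace ℝ (Fin n))} (hS : S ∈ Q k) :
    ∃ c ∈ S, S ⊆ dilatedBall A Δ c (v * k + u) := by
  obtain ⟨c, hc, -, h⟩ := hQ.balls k S hS
  exact ⟨c, hc, h c hc⟩

theorem IsDyadicGrid.volume_le (hQ : IsDyadicGrid A Δ v u Q) (hΔ : IsUnitEllipsoid A Δ)
    {k : ℤ} {S : Set (EuclideanSpace ℝ (Fin n))} (hS : S ∈ Q k) :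
    volume S ≤ (dilationFactor A ^ (v * k + u) : ℝ≥0) := by
  obtain ⟨c, -, h⟩ := hQ.exists_subset_dilatedBall hS
  exact (measure_mono h).trans_eq (hΔ.volume_dilatedBall _ _)

theorem IsDyadicGrid.le_volume (hQ : IsDyadicGrid A Δ v u Q) (hΔ : IsUnitEllipsoid A Δ)
    {k : ℤ} {S : Set (EuclideanSpace ℝ (Fin n))} (hS : S ∈ Q k) :
    (dilationFactor A ^ (v * k - u) : ℝ≥0) ≤ volume S := by
  obtain ⟨c, -, h, -⟩ := hQ.balls k S hS
  exact (hΔ.volume_dilatedBall _ _).symm.trans_le (measure_mono h)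

theorem IsDyadicGrid.volume_ne_zero (hQ : IsDyadicGrid A Δ v u Q) {k : ℤ}
    {S : Set (EuclideanSpace ℝ (Fin n))} (hS : S ∈ Q k) : volume S ≠ 0 :=
  ((hQ.isOpen k S hS).measure_pos volume (hQ.nonempty hS)).ne'

theorem IsDyadicGrid.volume_ne_top (hQ : IsDyadicGrid A Δ v u Q) (hΔ : IsUnitEllipsoid A Δ)
    {k : ℤ} {S : Set (EuclideanSpace ℝ (Fin n))} (hS : S ∈ Q k) :
    volume S ≠ ∞ :=
  ((hQ.volume_le hΔ hS).trans_lt ENNReal.coe_lt_top).ne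

theorem IsDyadicGrid.eq_of_mem (hQ : IsDyadicGrid A Δ v u Q) {k : ℤ}
    {S T : Set (EuclideanSpace ℝ (Fin n))} (hS : S ∈ Q k) (hT : T ∈ Q k)
    {x : EuclideanSpace ℝ (Fin n)} (hxS : x ∈ S) (hxT : x ∈ T) : S = T := by
  by_contra hne
  exact disjoint_left.1 (hQ.disjoint k S hS T hT hne) hxS hxT

theorem IsDyadicGrid.subset_of_mem (hQ : IsDyadicGrid A Δ v u Q) {k l : ℤ} (hkl : k ≤ l)
    {S T : Set (EuclideanSpace ℝ (Fin n))} (hS : S ∈ Q k) (hT : T ∈ Q l)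
    {x : EuclideanSpace ℝ (Fin n)} (hxS : x ∈ S) (hxT : x ∈ T) : T ⊆ S :=
  (hQ.nested k l hkl S hS T hT).resolve_left fun hd => disjoint_left.1 hd hxS hxT

/-- The chain of the ancestors of a cube. -/
theorem IsDyadicGrid.exists_ancestors (hQ : IsDyadicGrid A Δ v u Q) {l : ℤ}
    {S : Set (EuclideanSpace ℝ (Fin n))} (hS : S ∈ Q l) :
    ∃ a : ℕ → Set (EuclideanSpace ℝ (Fin n)), a 0 = S ∧ (∀ k : ℕ, a k ∈ Q (l - k)) ∧
      Monotone a := by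
  -- `parent` only concerns strictly coarser levels, so the start of the chain is pinned separately
  -- by the clause at `k = 0`.
  have h : ∀ k : ℕ, ∃ T ∈ Q (l - k), S ⊆ T ∧ (k = 0 → T = S) := by
    intro k
    rcases Nat.eq_zero_or_pos k with rfl | hk
    · exact ⟨S, by simpa using hS, Subset.rfl, fun _ => rfl⟩
    · obtain ⟨T, ⟨hT, hST⟩, -⟩ := hQ.parent (l - k) l (by omega) S hS
      exact ⟨T, hT, hST, by omega⟩
  choose a ha hSa h0 using h
  obtain ⟨x, hx⟩ := hQ.nonempty hS
  refine ⟨a, h0 0 rfl, ha, fun i j hij => ?_⟩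
  exact hQ.subset_of_mem (by omega) (ha j) (ha i) (hSa j hx) (hSa i hx)

/-- Every cube that contains `S` is an ancestor of `S`. -/
theorem IsDyadicGrid.exists_eq_ancestor (hQ : IsDyadicGrid A Δ v u Q) {l : ℤ}
    {S T : Set (EuclideanSpace ℝ (Fin n))} (hS : S ∈ Q l)
    {a : ℕ → Set (EuclideanSpace ℝ (Fin n))} (h0 : a 0 = S) (ha : ∀ k : ℕ, a k ∈ Q (l - k))
    (hmono : Monotone a) (hT : T ∈ dyadicCubes Q) (hST : S ⊆ T) : ∃ k, T = a k := by
  obtain ⟨l', hT⟩ := mem_iUnion.1 hT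
  obtain ⟨x, hx⟩ := hQ.nonempty hS
  rcases le_total l' l with hl | hl
  · obtain ⟨k, hk⟩ := Int.eq_ofNat_of_zero_le (sub_nonneg.2 hl)
    have hak := ha k
    rw [← hk, sub_sub_cancel] at hak
    exact ⟨k, hQ.eq_of_mem hT hak (hST hx) (hmono (Nat.zero_le k) (h0 ▸ hx))⟩
  -- One set may be a cube of several levels: a cube containing `S` but of a finer level must equal
  -- `S`.
  · exact ⟨0, h0 ▸ (hQ.subset_of_mem hl hS hT hx (hST hx)).antisymm hST⟩

end Geometry

/-! ### From the Muckenhoupt condition to mass bounds on cubes. -/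

section Weights

/-- The lower bound `(|F| / |S|) ^ q ≤ M f(F) / f(S)` for all subsets `F` of the sets `S ∈ D`. -/
def HasMassBound {n : ℕ} (D : Set (Set (EuclideanSpace ℝ (Fin n)))) (q : ℝ) (M : ℝ≥0∞)
    (f : EuclideanSpace ℝ (Fin n) → ℝ≥0∞) : Prop :=
  ∀ S ∈ D, ∀ F ⊆ S, volume F ^ q * ∫⁻ x in S, f x ≤ M * volume S ^ q * ∫⁻ x in F, f x

/-- Hölder's inequality for `1 = f ^ (1 / q) * f ^ (-1 / q)` on `F`. The factorization is valid
almost everywhere: finiteness of the dual integral excludes zeros of `f`, where the negative power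
is infinite. -/
theorem measure_rpow_le_lintegral_mul {α : Type*} [MeasurableSpace α] {μ : Measure α}
    {F B : Set α} (hFB : F ⊆ B) {f : α → ℝ≥0∞} (hf : AEMeasurable f (μ.restrict B))
    (hfin : ∀ x, f x ≠ ∞) {q : ℝ} (hq : 1 < q)
    (hσ : ∫⁻ x in B, f x ^ (-1 / (q - 1)) ∂μ ≠ ∞) :
    μ F ^ q ≤ (∫⁻ x in F, f x ∂μ) * (∫⁻ x in B, f x ^ (-1 / (q - 1)) ∂μ) ^ (q - 1) := by
  have hq0 : 0 < q := by linarith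
  have hq1 : 0 < q - 1 := by linarith
  have hfF : AEMeasurable f (μ.restrict F) := hf.mono_set hFB
  have hpos : ∀ᵐ x ∂μ.restrict F, f x ≠ 0 := by
    have := ae_lt_top' (hf.pow_const (-1 / (q - 1))) hσ
    filter_upwards [ae_restrict_of_ae_restrict_of_subset hFB this] with x hx h0
    rw [h0, ENNReal.zero_rpow_of_neg (div_neg_of_neg_of_pos (by norm_num) hq1)] at hx
    exact lt_irrefl _ hx
  have hconj : q.HolderConjugate (q / (q - 1)) := Real.HolderConjugate.conjExponent hq
  have h1 : μ F ≤ (∫⁻ x in F, f x ∂μ) ^ (1 / q) *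
      (∫⁻ x in F, f x ^ (-1 / (q - 1)) ∂μ) ^ (1 / (q / (q - 1))) := by
    calc μ F = ∫⁻ x in F, ((fun x => f x ^ (1 / q)) * fun x => f x ^ (-1 / q)) x ∂μ := by
          rw [← setLIntegral_one]
          refine lintegral_congr_ae ?_
          filter_upwards [hpos] with x hx
          rw [Pi.mul_apply, ← ENNReal.rpow_add _ _ hx (hfin x), ← add_div]
          simp
      _ ≤ _ := ENNReal.lintegral_mul_le_Lp_mul_Lq _ hconj (hfF.pow_const _) (hfF.pow_const _)
      _ = _ := by
          congr 3
          · ext x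
            rw [← ENNReal.rpow_mul, one_div_mul_cancel hq0.ne', ENNReal.rpow_one]
          · ext x
            rw [← ENNReal.rpow_mul]
            congr 1
            field_simp
  calc μ F ^ q ≤ ((∫⁻ x in F, f x ∂μ) ^ (1 / q) *
      (∫⁻ x in F, f x ^ (-1 / (q - 1)) ∂μ) ^ (1 / (q / (q - 1)))) ^ q :=
        ENNReal.rpow_le_rpow h1 hq0.le
    _ = (∫⁻ x in F, f x ∂μ) * (∫⁻ x in F, f x ^ (-1 / (q - 1)) ∂μ) ^ (q - 1) := by
        rw [ENNReal.mul_rpow_of_nonneg _ _ hq0.le, ← ENNReal.rpow_mul, ← ENNReal.rpow_mul,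
          one_div_mul_cancel hq0.ne', ENNReal.rpow_one]
        congr 2
        field_simp
    _ ≤ _ := by
        gcongr

theorem measure_rpow_mul_lintegral_le {α : Type*} [MeasurableSpace α] {μ : Measure α}
    {F B : Set α} (hFB : F ⊆ B) (hB0 : μ B ≠ 0) (hB : μ B ≠ ∞) {f : α → ℝ≥0∞}
    (hf : AEMeasurable f (μ.restrict B))
    (hfin : ∀ x, f x ≠ ∞) {q : ℝ} (hq : 1 < q) {K : ℝ≥0}
    (hK : (⨍⁻ x in B, f x ∂μ) * (⨍⁻ x in B, f x ^ (-1 / (q - 1)) ∂μ) ^ (q - 1) ≤ K) :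
    μ F ^ q * ∫⁻ x in B, f x ∂μ ≤ K * μ B ^ q * ∫⁻ x in F, f x ∂μ := by
  have hq1 : 0 < q - 1 := by linarith
  rw [setLAverage_eq, setLAverage_eq] at hK
  -- An infinite dual integral is compatible with a finite Muckenhoupt product only through `0 * ∞ =
  -- 0`, so `f` then has no mass on `B`.
  by_cases hσ : ∫⁻ x in B, f x ^ (-1 / (q - 1)) ∂μ = ∞
  · have h0 : ∫⁻ x in B, f x ∂μ = 0 := by
      by_contra h0
      rw [hσ, ENNReal.top_div_of_ne_top hB, ENNReal.top_rpow_of_pos hq1, ENNReal.mul_top] at hK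
      · exact ENNReal.coe_ne_top (top_le_iff.1 hK)
      · exact (ENNReal.div_pos h0 hB).ne'
    simp [h0]
  · have hsplit : (∫⁻ x in B, f x ∂μ) * (∫⁻ x in B, f x ^ (-1 / (q - 1)) ∂μ) ^ (q - 1) ≤
        K * μ B ^ q := by
      calc _ = ((∫⁻ x in B, f x ∂μ) / μ B *
            ((∫⁻ x in B, f x ^ (-1 / (q - 1)) ∂μ) / μ B) ^ (q - 1)) *
              (μ B * μ B ^ (q - 1)) := by
            rw [mul_mul_mul_comm, ENNReal.div_mul_cancel hB0 hB,
              ← ENNReal.mul_rpow_of_nonneg _ _ hq1.le, ENNReal.div_mul_cancel hB0 hB]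
        _ ≤ K * (μ B * μ B ^ (q - 1)) := by gcongr
        _ = K * μ B ^ q := by
            congr 1
            nth_rw 1 [← ENNReal.rpow_one (μ B)]
            rw [← ENNReal.rpow_add _ _ hB0 hB]
            ring_nf
    calc μ F ^ q * ∫⁻ x in B, f x ∂μ
        ≤ (∫⁻ x in F, f x ∂μ) * (∫⁻ x in B, f x ^ (-1 / (q - 1)) ∂μ) ^ (q - 1) *
          ∫⁻ x in B, f x ∂μ := by
          gcongr
          exact measure_rpow_le_lintegral_mul hFB hf hfin hq hσ
      _ = (∫⁻ x in F, f x ∂μ) *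
          ((∫⁻ x in B, f x ∂μ) * (∫⁻ x in B, f x ^ (-1 / (q - 1)) ∂μ) ^ (q - 1)) := by ring
      _ ≤ (∫⁻ x in F, f x ∂μ) * (K * μ B ^ q) := by gcongr
      _ = _ := by ring

variable {n : ℕ} {A : Matrix (Fin n) (Fin n) ℝ} {Δ : Set (EuclideanSpace ℝ (Fin n))}

theorem hasMassBound_dilatedBall (hΔ : IsUnitEllipsoid A Δ) (hb : 1 < dilationFactor A)
    {q : ℝ} (hq : 1 < q) {K : ℝ≥0} {w : EuclideanSpace ℝ (Fin n) → ℝ}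
    (hw : AEMeasurable w volume) (hK : muckenhouptConst A Δ q w ≤ K) :
    HasMassBound {B | ∃ x k, B = dilatedBall A Δ x k} q K (fun x => ENNReal.ofReal (w x)) := by
  rintro B ⟨x, k, rfl⟩ F hF
  have hvol := hΔ.volume_dilatedBall x k
  have hpos : (dilationFactor A ^ k : ℝ≥0) ≠ 0 := zpow_ne_zero _ (by positivity)
  refine measure_rpow_mul_lintegral_le hF ?_ ?_ hw.ennreal_ofReal.restrict
    (fun _ => ENNReal.ofReal_ne_top) hq ?_
  · rw [hvol]
    exact_mod_cast hpos
  · rw [hvol]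
    exact ENNReal.coe_ne_top
  · exact (le_iSup₂ (f := fun x k => (⨍⁻ y in dilatedBall A Δ x k, ENNReal.ofReal (w y) ∂volume) *
      (⨍⁻ y in dilatedBall A Δ x k, ENNReal.ofReal (w y) ^ (-1 / (q - 1)) ∂volume) ^ (q - 1))
      x k).trans hK

variable {v : ℤ} {u : ℕ} {Q : ℤ → Set (Set (EuclideanSpace ℝ (Fin n)))}

/-- The constant in the mass bound over dyadic cubes that results from a Muckenhoupt constant
`K`. -/
noncomputable def cubeMassConst (A : Matrix (Fin n) (Fin n) ℝ) (u : ℕ) (q : ℝ) (K : ℝ≥0) : ℝ≥0 :=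
  K * (dilationFactor A ^ (2 * u)) ^ q

/-- A cube lies in a ball of at most `b ^ (2 * u)` times its volume, so the bound for balls passes
to cubes at the cost of the factor `(b ^ (2 * u)) ^ q`. -/
theorem IsDyadicGrid.hasMassBound (hQ : IsDyadicGrid A Δ v u Q) (hΔ : IsUnitEllipsoid A Δ)
    (hb : 1 < dilationFactor A) {q : ℝ} (hq : 1 < q) {K : ℝ≥0}
    {w : EuclideanSpace ℝ (Fin n) → ℝ}
    (hw : AEMeasurable w volume) (hK : muckenhouptConst A Δ q w ≤ K) :
    HasMassBound (dyadicCubes Q) q (cubeMassConst A u q K) (fun x => ENNReal.ofReal (w x)) := by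
  intro S hS F hF
  obtain ⟨k, hS⟩ := mem_iUnion.1 hS
  obtain ⟨c, -, hc⟩ := hQ.exists_subset_dilatedBall hS
  have hball : volume (dilatedBall A Δ c (v * k + u)) ≤
      (dilationFactor A ^ (2 * u) : ℝ≥0) * volume S := by
    calc volume (dilatedBall A Δ c (v * k + u))
        = (dilationFactor A ^ (2 * u) * dilationFactor A ^ (v * k - u) : ℝ≥0) := by
          rw [hΔ.volume_dilatedBall, ← zpow_natCast, ← zpow_add₀ (by positivity)]
          congr 2
          push_cast
          ring
      _ ≤ _ := by
          rw [ENNReal.coe_mul]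
          gcongr
          exact hQ.le_volume hΔ hS
  calc volume F ^ q * ∫⁻ x in S, ENNReal.ofReal (w x)
      ≤ volume F ^ q * ∫⁻ x in dilatedBall A Δ c (v * k + u), ENNReal.ofReal (w x) := by
        gcongr
    _ ≤ K * volume (dilatedBall A Δ c (v * k + u)) ^ q * ∫⁻ x in F, ENNReal.ofReal (w x) :=
        hasMassBound_dilatedBall hΔ hb hq hw hK _ ⟨c, _, rfl⟩ F (hF.trans hc)
    _ ≤ K * ((dilationFactor A ^ (2 * u) : ℝ≥0) * volume S) ^ q *
          ∫⁻ x in F, ENNReal.ofReal (w x) := by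
        gcongr
    _ = _ := by
        rw [ENNReal.mul_rpow_of_nonneg _ _ (by linarith), cubeMassConst, ENNReal.coe_mul,
          ENNReal.coe_rpow_of_nonneg _ (by linarith : (0 : ℝ) ≤ q)]
        ring

/-- If the weight vanished on a cube, the mass bound on balls, tested on the intersection with that
cube, would make it vanish on every large ball about a point of the cube, hence almost everywhere.
-/
theorem IsDyadicGrid.lintegral_pos (hQ : IsDyadicGrid A Δ v u Q) (hΔ : IsUnitEllipsoid A Δ)
    (hb : 1 < dilationFactor A) {q : ℝ} (hq : 1 < q) {K : ℝ≥0}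
    {w : EuclideanSpace ℝ (Fin n) → ℝ} (hw : AEMeasurable w volume) (hw0 : ∀ x, 0 ≤ w x)
    (hnt : ¬ w =ᵐ[volume] 0) (hK : muckenhouptConst A Δ q w ≤ K) {k : ℤ}
    {S : Set (EuclideanSpace ℝ (Fin n))} (hS : S ∈ Q k) :
    ∫⁻ x in S, ENNReal.ofReal (w x) ≠ 0 := by
  intro h0
  obtain ⟨c, hc⟩ := hQ.nonempty hS
  have hball : ∀ j : ℕ, ∫⁻ x in dilatedBall A Δ c j, ENNReal.ofReal (w x) = 0 := by
    intro j
    have h1 := hasMassBound_dilatedBall hΔ hb hq hw hK _ ⟨c, j, rfl⟩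
      (S ∩ dilatedBall A Δ c j) inter_subset_right
    have h2 : ∫⁻ x in S ∩ dilatedBall A Δ c j, ENNReal.ofReal (w x) = 0 :=
      le_antisymm ((lintegral_mono_set inter_subset_left).trans h0.le) zero_le
    rw [h2, mul_zero, nonpos_iff_eq_zero, mul_eq_zero] at h1
    refine h1.resolve_left ?_
    have hpos : 0 < volume (S ∩ dilatedBall A Δ c j) :=
      ((hQ.isOpen k S hS).inter (hΔ.isOpen_dilatedBall hb c j)).measure_pos volume
        ⟨c, hc, hΔ.mem_dilatedBall c j⟩
    intro h3
    rcases ENNReal.rpow_eq_zero_iff.1 h3 with h4 | h4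
    · exact hpos.ne' h4.1
    · linarith [h4.2]
  apply hnt
  have hae : ∀ᵐ x ∂volume.restrict (⋃ j : ℕ, dilatedBall A Δ c j), w x = 0 := by
    rw [ae_restrict_iUnion_iff]
    intro j
    filter_upwards [(lintegral_eq_zero_iff' hw.ennreal_ofReal.restrict).1 (hball j)] with x hx
    exact le_antisymm (ENNReal.ofReal_eq_zero.1 hx) (hw0 x)
  rw [hΔ.iUnion_dilatedBall, Measure.restrict_univ] at hae
  exact hae

end Weights

/-! ### Decay of density along ancestors and existence of the largest enlargement. -/

section Enlargements

variable {n : ℕ} {A : Matrix (Fin n) (Fin n) ℝ} {Δ : Set (EuclideanSpace ℝ (Fin n))}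
  {v : ℤ} {u : ℕ} {Q : ℤ → Set (Set (EuclideanSpace ℝ (Fin n)))}

theorem IsDyadicGrid.tendsto_volume_ancestors (hQ : IsDyadicGrid A Δ v u Q)
    (hΔ : IsUnitEllipsoid A Δ) (hb : 1 < dilationFactor A) (hv : v < 0) {l : ℤ}
    {a : ℕ → Set (EuclideanSpace ℝ (Fin n))} (ha : ∀ k : ℕ, a k ∈ Q (l - k)) :
    Filter.Tendsto (fun k => volume (a k)) Filter.atTop (nhds ∞) := by
  have hpow : Filter.Tendsto (fun k : ℕ => dilationFactor A ^ (v * l - u) * dilationFactor A ^ k)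
      Filter.atTop Filter.atTop :=
    (tendsto_pow_atTop_atTop_of_one_lt hb).const_mul_atTop' (by positivity)
  refine tendsto_nhds_top_mono' (ENNReal.tendsto_coe_nhds_top.2 hpow) fun k => ?_
  refine le_trans ?_ (hQ.le_volume hΔ (ha k))
  rw [ENNReal.coe_le_coe, ← zpow_natCast, ← zpow_add₀ (by positivity)]
  refine zpow_le_zpow_right₀ hb.le ?_
  nlinarith [Int.natCast_nonneg k]

/-- Suppose the union `U` of the chain had finite mass. Given `j`, choose `a k` of more than twice
the volume of `a j`; then `a k \ a j` fills at least half of `a k`, so the mass of `a 0` is at most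
`M * 2 ^ q` times the mass of `U \ a j`. The latter tends to zero, contradicting `h0`. -/
theorem IsDyadicGrid.tendsto_lintegral_ancestors (hQ : IsDyadicGrid A Δ v u Q)
    (hΔ : IsUnitEllipsoid A Δ) (hb : 1 < dilationFactor A) (hv : v < 0) {l : ℤ}
    {a : ℕ → Set (EuclideanSpace ℝ (Fin n))} (ha : ∀ k : ℕ, a k ∈ Q (l - k)) (hmono : Monotone a)
    {q : ℝ} (hq : 1 < q) {M : ℝ≥0} {f : EuclideanSpace ℝ (Fin n) → ℝ≥0∞}
    (hf : HasMassBound (dyadicCubes Q) q M f) (h0 : ∫⁻ x in a 0, f x ≠ 0) :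
    Filter.Tendsto (fun k => ∫⁻ x in a k, f x) Filter.atTop (nhds ∞) := by
  have hq0 : 0 ≤ q := by linarith
  have hmeas : ∀ k, MeasurableSet (a k) := fun k => (hQ.isOpen _ _ (ha k)).measurableSet
  set ρ := volume.withDensity f with hρ
  have hρa : ∀ S, MeasurableSet S → ρ S = ∫⁻ x in S, f x := fun S hS => withDensity_apply _ hS
  set U := ⋃ k, a k with hU
  have hlim : Filter.Tendsto (fun k => ρ (a k)) Filter.atTop (nhds (ρ U)) :=
    tendsto_measure_iUnion_atTop hmono
  have hUtop : ρ U = ∞ := by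
    by_contra hfin
    have hdiff : Filter.Tendsto (fun j => (M : ℝ≥0∞) * 2 ^ q * (ρ U - ρ (a j))) Filter.atTop
        (nhds (M * 2 ^ q * (ρ U - ρ U))) := by
      refine ENNReal.Tendsto.const_mul (ENNReal.Tendsto.sub tendsto_const_nhds hlim (Or.inl hfin))
        (Or.inr ?_)
      exact ENNReal.mul_ne_top ENNReal.coe_ne_top
        (ENNReal.rpow_ne_top_of_nonneg hq0 (by norm_num))
    rw [tsub_self, mul_zero] at hdiff
    have hle : ∀ j, ρ (a 0) ≤ M * 2 ^ q * (ρ U - ρ (a j)) := by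
      intro j
      have hj : 2 * volume (a j) ≠ ∞ :=
        ENNReal.mul_ne_top (by norm_num) (hQ.volume_ne_top hΔ (ha j))
      obtain ⟨k, hk, hjk⟩ := (((hQ.tendsto_volume_ancestors hΔ hb hv ha).eventually
        (lt_mem_nhds (lt_top_iff_ne_top.2 hj))).and (Filter.eventually_ge_atTop j)).exists
      have hV0 := hQ.volume_ne_zero (ha k)
      have hVt := hQ.volume_ne_top hΔ (ha k)
      have hhalf : volume (a k) ≤ 2 * volume (a k \ a j) := by
        have h1 : volume (a k \ a j) + volume (a j) = volume (a k) :=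
          by rw [measure_sdiff_add_inter (a k) (hmeas j) |>.symm, inter_eq_right.2 (hmono hjk)]
        refine ENNReal.le_of_add_le_add_right hVt ?_
        calc volume (a k) + volume (a k) = 2 * volume (a k \ a j) + 2 * volume (a j) := by
              rw [← mul_add, h1, two_mul]
          _ ≤ _ := by gcongr
      have h1 := hf (a k) (mem_iUnion.2 ⟨_, ha k⟩) (a k \ a j) sdiff_subset
      rw [← hρa _ (hmeas k), ← hρa _ ((hmeas k).diff (hmeas j))] at h1
      have h2 : volume (a k) ^ q * ρ (a k) ≤
          volume (a k) ^ q * (M * 2 ^ q * ρ (a k \ a j)) := by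
        calc volume (a k) ^ q * ρ (a k) ≤ (2 * volume (a k \ a j)) ^ q * ρ (a k) := by gcongr
          _ = 2 ^ q * (volume (a k \ a j) ^ q * ρ (a k)) := by
            rw [ENNReal.mul_rpow_of_nonneg _ _ hq0, mul_assoc]
          _ ≤ 2 ^ q * (M * volume (a k) ^ q * ρ (a k \ a j)) := by gcongr
          _ = _ := by ring
      rw [ENNReal.mul_le_mul_iff_right (by simp [hV0, hVt])
        (ENNReal.rpow_ne_top_of_nonneg hq0 hVt)] at h2
      refine (measure_mono (hmono (Nat.zero_le k))).trans (h2.trans ?_)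
      gcongr
      rw [← measure_sdiff (subset_iUnion a j) (hmeas j).nullMeasurableSet
        (measure_ne_top_of_subset (subset_iUnion a j) hfin)]
      exact measure_mono (sdiff_subset_sdiff_left (subset_iUnion a k))
    have := ge_of_tendsto' hdiff hle
    rw [hρa _ (hmeas 0)] at this
    exact h0 (le_antisymm this zero_le)
  rw [hUtop] at hlim
  simpa only [hρa _ (hmeas _)] using hlim

/-- The mass bound for the subset `a k ∩ G` bounds the `q`-th power of the density by `M` times the
mass of `G` over the mass of `a k`, whose denominator tends to infinity. -/
theorem IsDyadicGrid.tendsto_density_ancestors (hQ : IsDyadicGrid A Δ v u Q)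
    (hΔ : IsUnitEllipsoid A Δ) (hb : 1 < dilationFactor A) (hv : v < 0) {l : ℤ}
    {a : ℕ → Set (EuclideanSpace ℝ (Fin n))} (ha : ∀ k : ℕ, a k ∈ Q (l - k)) (hmono : Monotone a)
    {q : ℝ} (hq : 1 < q) {M : ℝ≥0} {f : EuclideanSpace ℝ (Fin n) → ℝ≥0∞}
    (hf : HasMassBound (dyadicCubes Q) q M f) (h0 : ∫⁻ x in a 0, f x ≠ 0)
    {G : Set (EuclideanSpace ℝ (Fin n))} (hG : ∫⁻ x in G, f x ≠ ∞) :
    Filter.Tendsto (fun k => volume (a k ∩ G) / volume (a k)) Filter.atTop (nhds 0) := by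
  have hq0 : 0 < q := by linarith
  have hN : (M : ℝ≥0∞) * ∫⁻ x in G, f x ≠ ∞ := ENNReal.mul_ne_top ENNReal.coe_ne_top hG
  have hlim : Filter.Tendsto (fun k => ((M : ℝ≥0∞) * ∫⁻ x in G, f x) / ∫⁻ x in a k, f x)
      Filter.atTop (nhds 0) := by
    have := ENNReal.Tendsto.const_div
      (hQ.tendsto_lintegral_ancestors hΔ hb hv ha hmono hq hf h0) (Or.inr hN)
    simpa using this
  have hpow : Filter.Tendsto (fun k => (volume (a k ∩ G) / volume (a k)) ^ q)
      Filter.atTop (nhds 0) := by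
    refine tendsto_of_tendsto_of_tendsto_of_le_of_le tendsto_const_nhds hlim
      (fun _ => zero_le) fun k => ?_
    have hV0 := hQ.volume_ne_zero (ha k)
    have hVt := hQ.volume_ne_top hΔ (ha k)
    have hk0 : ∫⁻ x in a k, f x ≠ 0 := by
      intro hk
      exact h0 (le_antisymm ((lintegral_mono_set (hmono (Nat.zero_le k))).trans hk.le) zero_le)
    rw [ENNReal.le_div_iff_mul_le (Or.inl hk0) (Or.inr hN), ENNReal.div_rpow_of_nonneg _ _ hq0.le,
      ← ENNReal.mul_div_right_comm]
    refine ENNReal.div_le_of_le_mul ?_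
    calc volume (a k ∩ G) ^ q * ∫⁻ x in a k, f x
        ≤ M * volume (a k) ^ q * ∫⁻ x in a k ∩ G, f x :=
          hf (a k) (mem_iUnion.2 ⟨_, ha k⟩) _ inter_subset_left
      _ ≤ M * volume (a k) ^ q * ∫⁻ x in G, f x := by
          gcongr
          exact inter_subset_right
      _ = _ := by ring
  have := hpow.ennrpow_const (1 / q)
  rw [ENNReal.zero_rpow_of_pos (by positivity)] at this
  refine this.congr fun k => ?_
  rw [← ENNReal.rpow_mul, mul_one_div_cancel hq0.ne', ENNReal.rpow_one]

variable {m : ℕ}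

/-- By Fubini almost every slice of `Ω` has finite weight, so slice densities tend to zero; they are
at most one and `R` has finite volume, so dominated convergence applies. -/
theorem IsDyadicGrid.tendsto_density_prod_ancestors (hQ : IsDyadicGrid A Δ v u Q)
    (hΔ : IsUnitEllipsoid A Δ) (hb : 1 < dilationFactor A) (hv : v < 0) {l : ℤ}
    {a : ℕ → Set (EuclideanSpace ℝ (Fin n))} (ha : ∀ k : ℕ, a k ∈ Q (l - k)) (hmono : Monotone a)
    {q : ℝ} (hq : 1 < q) {M : ℝ≥0}
    {f : EuclideanSpace ℝ (Fin m) × EuclideanSpace ℝ (Fin n) → ℝ≥0∞} (hfm : AEMeasurable f volume)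
    (hf : ∀ᵐ x, HasMassBound (dyadicCubes Q) q M fun y => f (x, y))
    (h0 : ∀ᵐ x, ∫⁻ y in a 0, f (x, y) ≠ 0)
    {Ω : Set (EuclideanSpace ℝ (Fin m) × EuclideanSpace ℝ (Fin n))} (hΩ : MeasurableSet Ω)
    (hfΩ : ∫⁻ z in Ω, f z ≠ ∞) {R : Set (EuclideanSpace ℝ (Fin m))} (hR : MeasurableSet R)
    (hRtop : volume R ≠ ∞) :
    Filter.Tendsto (fun k => volume ((R ×ˢ a k) ∩ Ω) / volume (a k)) Filter.atTop (nhds 0) := by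
  have hmeas : ∀ k, MeasurableSet (a k) := fun k => (hQ.isOpen _ _ (ha k)).measurableSet
  have hΩx : ∀ x, MeasurableSet (Prod.mk x ⁻¹' Ω) := fun x => measurable_prodMk_left hΩ
  have hfin : ∀ᵐ x, ∫⁻ y in Prod.mk x ⁻¹' Ω, f (x, y) ≠ ∞ := by
    rw [← lintegral_indicator hΩ, Measure.volume_eq_prod,
      lintegral_prod _ (hfm.indicator hΩ)] at hfΩ
    filter_upwards [ae_lt_top' (hfm.indicator hΩ).lintegral_prod_right' hfΩ] with x hx
    rw [← lintegral_indicator (hΩx x)]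
    exact hx.ne
  have hm : ∀ k, Measurable fun x => volume (a k ∩ Prod.mk x ⁻¹' Ω) := fun k => by
    have := measurable_measure_prodMk_left (ν := (volume : Measure (EuclideanSpace ℝ (Fin n))))
      (((MeasurableSet.univ (α := EuclideanSpace ℝ (Fin m))).prod (hmeas k)).inter hΩ)
    convert this using 3
    ext y
    simp
  have hlim := tendsto_lintegral_of_dominated_convergence (μ := volume.restrict R)
    (F := fun k x => volume (a k ∩ Prod.mk x ⁻¹' Ω) / volume (a k)) (f := fun _ => 0)
    (fun _ => 1) ?_ ?_ ?_ ?_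
  · rw [lintegral_zero] at hlim
    refine hlim.congr fun k => ?_
    have hdiv : ∫⁻ x in R, volume (a k ∩ Prod.mk x ⁻¹' Ω) / volume (a k) =
        (∫⁻ x in R, volume (a k ∩ Prod.mk x ⁻¹' Ω)) / volume (a k) := by
      simp only [div_eq_mul_inv]
      rw [lintegral_mul_const _ (hm k)]
    rw [hdiv, Measure.volume_eq_prod, Measure.prod_apply ((hR.prod (hmeas k)).inter hΩ),
      ← lintegral_indicator hR]
    congr 1
    refine lintegral_congr fun x => ?_
    by_cases hx : x ∈ R
    · rw [indicator_of_mem hx]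
      congr 1
      ext y
      simp [hx]
    · rw [indicator_of_notMem hx]
      symm
      convert measure_empty (μ := (volume : Measure (EuclideanSpace ℝ (Fin n))))
      ext y
      simp [hx]
  · exact fun k => (hm k).div_const _
  · intro k
    refine Filter.Eventually.of_forall fun x => ?_
    exact ENNReal.div_le_of_le_mul (by rw [one_mul]; exact measure_mono inter_subset_left)
  · simpa using hRtop
  · refine ae_restrict_of_ae ?_
    filter_upwards [hf, h0, hfin] with x hx h0x hfx
    exact hQ.tendsto_density_ancestors hΔ hb hv ha hmono hq hx h0x hfx

/-- The admissible indices contain zero and are bounded, so `k` is their supremum. The failure of `a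
(k + 1)` is recorded because the packing argument uses that cube, not `a k`. -/
theorem IsDyadicGrid.exists_isGreatest_enlargements (hQ : IsDyadicGrid A Δ v u Q)
    (hΔ : IsUnitEllipsoid A Δ) (hb : 1 < dilationFactor A) (hv : v < 0) {l : ℤ}
    {a : ℕ → Set (EuclideanSpace ℝ (Fin n))} (ha : ∀ k : ℕ, a k ∈ Q (l - k)) (hmono : Monotone a)
    {q : ℝ} (hq : 1 < q) {M : ℝ≥0}
    {f : EuclideanSpace ℝ (Fin m) × EuclideanSpace ℝ (Fin n) → ℝ≥0∞} (hfm : AEMeasurable f volume)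
    (hf : ∀ᵐ x, HasMassBound (dyadicCubes Q) q M fun y => f (x, y))
    (h0 : ∀ᵐ x, ∫⁻ y in a 0, f (x, y) ≠ 0)
    {Ω : Set (EuclideanSpace ℝ (Fin m) × EuclideanSpace ℝ (Fin n))} (hΩ : MeasurableSet Ω)
    (hfΩ : ∫⁻ z in Ω, f z ≠ ∞) {R : Set (EuclideanSpace ℝ (Fin m))} (hR : MeasurableSet R)
    (hR0 : volume R ≠ 0) (hRtop : volume R ≠ ∞) (hsub : R ×ˢ a 0 ⊆ Ω) {η : ℝ} (hη₀ : 0 < η)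
    (hη₁ : η < 1) :
    ∃ k, IsGreatest (enlargements₂ Q η Ω (R, a 0)) (a k) ∧
      a (k + 1) ∉ enlargements₂ Q η Ω (R, a 0) := by
  have hmem : ∀ k, a k ∈ enlargements₂ Q η Ω (R, a 0) ↔
      ENNReal.ofReal η * volume (R ×ˢ a k) < volume ((R ×ˢ a k) ∩ Ω) := fun k =>
    ⟨fun h => h.2.2, fun h => ⟨mem_iUnion.2 ⟨_, ha k⟩, hmono (Nat.zero_le k), h⟩⟩
  have hprod : ∀ k, volume (R ×ˢ a k) = volume R * volume (a k) := fun k => by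
    rw [Measure.volume_eq_prod, Measure.prod_prod]
  set s : Set ℕ := {k | a k ∈ enlargements₂ Q η Ω (R, a 0)} with hs
  have hs0 : 0 ∈ s := by
    rw [hs, mem_ofPred_eq, hmem, inter_eq_left.2 hsub]
    have hpos : volume (R ×ˢ a 0) ≠ 0 := by
      rw [hprod]
      exact mul_ne_zero hR0 (hQ.volume_ne_zero (ha 0))
    have htop : volume (R ×ˢ a 0) ≠ ∞ := by
      rw [hprod]
      exact ENNReal.mul_ne_top hRtop (hQ.volume_ne_top hΔ (ha 0))
    calc ENNReal.ofReal η * volume (R ×ˢ a 0) < 1 * volume (R ×ˢ a 0) := by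
          refine ENNReal.mul_lt_mul_left hpos htop ?_
          exact ENNReal.ofReal_lt_one.2 hη₁
      _ = _ := one_mul _
  have hbdd : BddAbove s := by
    have hlim := hQ.tendsto_density_prod_ancestors hΔ hb hv ha hmono hq hfm hf h0 hΩ hfΩ hR hRtop
    have hpos : 0 < ENNReal.ofReal η * volume R :=
      ENNReal.mul_pos (ENNReal.ofReal_pos.2 hη₀).ne' hR0
    obtain ⟨N, hN⟩ := Filter.eventually_atTop.1 (hlim.eventually (gt_mem_nhds hpos))
    refine ⟨N, fun k hk => ?_⟩
    by_contra! hlt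
    have h1 := (hmem k).1 hk
    have h2 := (ENNReal.div_le_iff (hQ.volume_ne_zero (ha k)) (hQ.volume_ne_top hΔ (ha k))).1
      (hN k hlt.le).le
    rw [hprod, ← mul_assoc] at h1
    exact (h1.trans_le h2).false
  refine ⟨sSup s, ⟨Nat.sSup_mem ⟨0, hs0⟩ hbdd, fun T hT => ?_⟩, fun h => ?_⟩
  · obtain ⟨k, rfl⟩ := hQ.exists_eq_ancestor (by simpa using ha 0) rfl ha hmono hT.1 hT.2.1
    exact hmono (le_csSup hbdd hT)
  · have := le_csSup hbdd (show sSup s + 1 ∈ s from h)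
    omega

end Enlargements

/-! ### Removing the dyadic base, and bounding the overlap of what remains. -/

section Packing

theorem card_le_of_forall_lt_add (s : Finset ℤ) (j : ℕ) (h : ∀ a ∈ s, ∀ b ∈ s, b < a + j) :
    s.card ≤ j := by
  rcases s.eq_empty_or_nonempty with rfl | hs
  · simp
  · have hsub : s ⊆ Finset.Ico (s.min' hs) (s.min' hs + j) := fun b hb =>
      Finset.mem_Ico.2 ⟨s.min'_le b hb, h _ (s.min'_mem hs) b hb⟩
    simpa using Finset.card_le_card hsub

variable {n m : ℕ} {A₁ : Matrix (Fin n) (Fin n) ℝ} {Δ₁ : Set (EuclideanSpace ℝ (Fin n))}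
  {A₂ : Matrix (Fin m) (Fin m) ℝ} {Δ₂ : Set (EuclideanSpace ℝ (Fin m))}
  {v₁ v₂ : ℤ} {u₁ u₂ : ℕ} {Q₁ : ℤ → Set (Set (EuclideanSpace ℝ (Fin n)))}
  {Q₂ : ℤ → Set (Set (EuclideanSpace ℝ (Fin m)))}
  {Ω : Set (EuclideanSpace ℝ (Fin n) × EuclideanSpace ℝ (Fin m))}

/-- The union of the dyadic cubes `S` of the first factor with `S × J ⊆ Ω`. -/
def dyadicBase (Q₁ : ℤ → Set (Set (EuclideanSpace ℝ (Fin n))))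
    (Ω : Set (EuclideanSpace ℝ (Fin n) × EuclideanSpace ℝ (Fin m)))
    (J : Set (EuclideanSpace ℝ (Fin m))) : Set (EuclideanSpace ℝ (Fin n)) :=
  ⋃₀ {S | S ∈ dyadicCubes Q₁ ∧ S ×ˢ J ⊆ Ω}

theorem IsDyadicGrid.isOpen_dyadicBase (hQ₁ : IsDyadicGrid A₁ Δ₁ v₁ u₁ Q₁)
    (J : Set (EuclideanSpace ℝ (Fin m))) : IsOpen (dyadicBase Q₁ Ω J) := by
  refine isOpen_sUnion fun S hS => ?_
  obtain ⟨k, hk⟩ := mem_iUnion.1 hS.1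
  exact hQ₁.isOpen k S hk

theorem dyadicBase_prod_subset (J : Set (EuclideanSpace ℝ (Fin m))) :
    dyadicBase Q₁ Ω J ×ˢ J ⊆ Ω := by
  rintro ⟨x, y⟩ ⟨⟨S, hS, hx⟩, hy⟩
  exact hS.2 ⟨hx, hy⟩

/-- The product of `dyadicBase Q₁ Ω J` with `J` lies in `Ω`, so the small density of `Ω` in `R ×ˢ J`
becomes, after division by the volume of `J`, a bound on the part of `R` in the base. -/
theorem volume_le_volume_diff_dyadicBase (hQ₁ : IsDyadicGrid A₁ Δ₁ v₁ u₁ Q₁)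
    {R : Set (EuclideanSpace ℝ (Fin n))} (hR : volume R ≠ ∞)
    {J : Set (EuclideanSpace ℝ (Fin m))} (hJ0 : volume J ≠ 0) (hJ : volume J ≠ ∞) {η : ℝ}
    (hη₀ : 0 < η) (hη₁ : η < 1)
    (h : volume ((R ×ˢ J) ∩ Ω) ≤ ENNReal.ofReal η * volume (R ×ˢ J)) :
    ENNReal.ofReal (1 - η) * volume R ≤ volume (R \ dyadicBase Q₁ Ω J) := by
  have h1 : volume (R ∩ dyadicBase Q₁ Ω J) ≤ ENNReal.ofReal η * volume R := by
    have h2 : volume ((R ∩ dyadicBase Q₁ Ω J) ×ˢ J) ≤ ENNReal.ofReal η * volume (R ×ˢ J) := by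
      refine (measure_mono fun z hz => ?_).trans h
      exact ⟨⟨hz.1.1, hz.2⟩, dyadicBase_prod_subset J ⟨hz.1.2, hz.2⟩⟩
    rwa [Measure.volume_eq_prod, Measure.prod_prod, Measure.prod_prod, ← mul_assoc,
      ENNReal.mul_le_mul_iff_left hJ0 hJ] at h2
  have h3 := measure_inter_add_sdiff (μ := volume) R (hQ₁.isOpen_dyadicBase (Ω := Ω) J).measurableSet
  refine ENNReal.le_of_add_le_add_left
    (ENNReal.mul_ne_top (ENNReal.ofReal_ne_top (r := η)) hR) ?_
  calc ENNReal.ofReal η * volume R + ENNReal.ofReal (1 - η) * volume R = volume R := by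
        rw [← add_mul, ← ENNReal.ofReal_add hη₀.le (by linarith)]
        simp
    _ = _ := h3.symm
    _ ≤ _ := by gcongr

/-- The mass bound is applied in the first variable for almost every `y` and then integrated over
`I`, which may therefore be arbitrary. -/
theorem lintegral_prod_le_lintegral_prod_diff (hQ₁ : IsDyadicGrid A₁ Δ₁ v₁ u₁ Q₁)
    (hΔ₁ : IsUnitEllipsoid A₁ Δ₁) {q : ℝ} (hq : 1 < q) {M : ℝ≥0}
    {f : EuclideanSpace ℝ (Fin n) × EuclideanSpace ℝ (Fin m) → ℝ≥0∞} (hfm : AEMeasurable f volume)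
    (hf : ∀ᵐ y, HasMassBound (dyadicCubes Q₁) q M fun x => f (x, y))
    {k : ℤ} {R : Set (EuclideanSpace ℝ (Fin n))} (hR : R ∈ Q₁ k)
    {E : Set (EuclideanSpace ℝ (Fin n))} {η : ℝ} (hη₁ : η < 1)
    (hE : ENNReal.ofReal (1 - η) * volume R ≤ volume (R \ E))
    (I : Set (EuclideanSpace ℝ (Fin m))) :
    ∫⁻ z in R ×ˢ I, f z ≤ M / ENNReal.ofReal (1 - η) ^ q * ∫⁻ z in (R \ E) ×ˢ I, f z := by
  have hq0 : 0 ≤ q := by linarith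
  have hη0 : ENNReal.ofReal (1 - η) ≠ 0 := (ENNReal.ofReal_pos.2 (by linarith)).ne'
  have hηq0 : ENNReal.ofReal (1 - η) ^ q ≠ 0 := by simp [hη0]
  have hηqt : ENNReal.ofReal (1 - η) ^ q ≠ ∞ :=
    ENNReal.rpow_ne_top_of_nonneg hq0 ENNReal.ofReal_ne_top
  have hslice : ∀ᵐ y, ∫⁻ x in R, f (x, y) ≤
      M / ENNReal.ofReal (1 - η) ^ q * ∫⁻ x in R \ E, f (x, y) := by
    filter_upwards [hf] with y hy
    have hV0 := hQ₁.volume_ne_zero hR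
    have hVt := hQ₁.volume_ne_top hΔ₁ hR
    have h1 := hy R (mem_iUnion.2 ⟨k, hR⟩) (R \ E) sdiff_subset
    have h2 : volume R ^ q * (ENNReal.ofReal (1 - η) ^ q * ∫⁻ x in R, f (x, y)) ≤
        volume R ^ q * (M * ∫⁻ x in R \ E, f (x, y)) := by
      calc _ = (ENNReal.ofReal (1 - η) * volume R) ^ q * ∫⁻ x in R, f (x, y) := by
            rw [ENNReal.mul_rpow_of_nonneg _ _ hq0]
            ring
        _ ≤ volume (R \ E) ^ q * ∫⁻ x in R, f (x, y) := by gcongr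
        _ ≤ _ := h1
        _ = _ := by ring
    rw [ENNReal.mul_le_mul_iff_right (by simp [hV0, hVt])
      (ENNReal.rpow_ne_top_of_nonneg hq0 hVt)] at h2
    rw [← ENNReal.mul_div_right_comm, ENNReal.le_div_iff_mul_le (Or.inl hηq0) (Or.inl hηqt),
      mul_comm]
    exact h2
  have hfub : ∀ S : Set (EuclideanSpace ℝ (Fin n)),
      ∫⁻ z in S ×ˢ I, f z = ∫⁻ y in I, ∫⁻ x in S, f (x, y) := by
    intro S
    rw [Measure.volume_eq_prod, ← Measure.prod_restrict, lintegral_prod_symm]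
    rw [Measure.prod_restrict, ← Measure.volume_eq_prod]
    exact hfm.restrict
  rw [hfub, hfub, ← lintegral_const_mul' _ _ (ENNReal.div_ne_top ENNReal.coe_ne_top hηq0)]
  exact lintegral_mono_ae (ae_restrict_of_ae hslice)

/-- The rectangles of `m₁(Ω)` whose second side has its `k`-th ancestor of small density have an
overlap of at most `k`. -/
theorem sum_indicator_diff_dyadicBase_le (hQ₁ : IsDyadicGrid A₁ Δ₁ v₁ u₁ Q₁)
    (hQ₂ : IsDyadicGrid A₂ Δ₂ v₂ u₂ Q₂)
    {lev : maximalRects₁ Q₁ Q₂ Ω → ℤ} (hlev : ∀ R, R.1.2 ∈ Q₂ (lev R))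
    {gap : maximalRects₁ Q₁ Q₂ Ω → ℕ}
    {J : maximalRects₁ Q₁ Q₂ Ω → Set (EuclideanSpace ℝ (Fin m))}
    (hJ : ∀ R, J R ∈ Q₂ (lev R - gap R)) (hRJ : ∀ R, R.1.2 ⊆ J R) (H : ℕ → ℝ≥0∞)
    (T : Finset (maximalRects₁ Q₁ Q₂ Ω))
    (z : EuclideanSpace ℝ (Fin n) × EuclideanSpace ℝ (Fin m)) :
    ∑ R ∈ T, H (gap R) * ((R.1.1 \ dyadicBase Q₁ Ω (J R)) ×ˢ R.1.2).indicator 1 z ≤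
      (∑' j : ℕ, j * H j) * Ω.indicator 1 z := by
  classical
  by_cases hz : z ∈ Ω
  swap
  · refine (Finset.sum_eq_zero fun R _ => ?_).trans_le zero_le
    rw [indicator_of_notMem, mul_zero]
    exact fun h => hz (R.2.2.2.1 ⟨h.1.1, h.2⟩)
  rw [indicator_of_mem hz, Pi.one_apply, mul_one]
  set P := T.filter fun R => z ∈ (R.1.1 \ dyadicBase Q₁ Ω (J R)) ×ˢ R.1.2 with hP
  have hPz : ∀ R ∈ P, z ∈ (R.1.1 \ dyadicBase Q₁ Ω (J R)) ×ˢ R.1.2 := fun R hR =>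
    (Finset.mem_filter.1 hR).2
  have hcard : ∀ j, (P.filter fun R => gap R = j).card ≤ j := by
    intro j
    -- Rectangles through `z` are counted by the level of their second side: equal levels give equal
    -- second sides, and then nestedness and maximality identify the first sides.
    have hinj : Set.InjOn lev (P.filter fun R => gap R = j) := by
      intro R hR R' hR' hll
      have hz1 := hPz R (Finset.mem_filter.1 hR).1
      have hz2 := hPz R' (Finset.mem_filter.1 hR').1
      have hI : R.1.2 = R'.1.2 := hQ₂.eq_of_mem (hlev R) (hll ▸ hlev R') hz1.2 hz2.2
      have hS : R.1.1 = R'.1.1 := by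
        obtain ⟨k, hk⟩ := mem_iUnion.1 R.2.1
        obtain ⟨k', hk'⟩ := mem_iUnion.1 R'.2.1
        rcases le_total k k' with hkk | hkk
        · exact R'.2.2.2.2 _ R.2.1 (hQ₁.subset_of_mem hkk hk hk' hz1.1.1 hz2.1.1)
            (hI ▸ R.2.2.2.1)
        · exact (R.2.2.2.2 _ R'.2.1 (hQ₁.subset_of_mem hkk hk' hk hz2.1.1 hz1.1.1)
            (hI ▸ R'.2.2.2.1)).symm
      exact Subtype.ext (Prod.ext hS hI)
    rw [← Finset.card_image_of_injOn hinj]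
    refine card_le_of_forall_lt_add _ _ fun a ha b hb => ?_
    obtain ⟨R, hR, rfl⟩ := Finset.mem_image.1 ha
    obtain ⟨R', hR', rfl⟩ := Finset.mem_image.1 hb
    have hz1 := hPz R (Finset.mem_filter.1 hR).1
    have hz2 := hPz R' (Finset.mem_filter.1 hR').1
    have hg := (Finset.mem_filter.1 hR').2
    by_contra! hle
    -- With a level difference of at least `j`, the cube `J R'` is no coarser than the second side
    -- of `R`. Then `R.1.1` belongs to the base of `J R'`, from which `z.1` was excluded.
    have hsub : J R' ⊆ R.1.2 :=
      hQ₂.subset_of_mem (by omega) (hlev R) (hJ R') hz1.2 (hRJ R' hz2.2)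
    exact hz2.1.2 ⟨R.1.1, ⟨R.2.1, (prod_mono_right hsub).trans R.2.2.2.1⟩, hz1.1.1⟩
  calc ∑ R ∈ T, H (gap R) * ((R.1.1 \ dyadicBase Q₁ Ω (J R)) ×ˢ R.1.2).indicator 1 z
      = ∑ R ∈ P, H (gap R) := by
        rw [hP, Finset.sum_filter]
        refine Finset.sum_congr rfl fun R _ => ?_
        by_cases h : z ∈ (R.1.1 \ dyadicBase Q₁ Ω (J R)) ×ˢ R.1.2
        · rw [indicator_of_mem h, if_pos h, Pi.one_apply, mul_one]
        · rw [indicator_of_notMem h, if_neg h, mul_zero]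
    _ = ∑ j ∈ P.image gap, (P.filter fun R => gap R = j).card • H j := Finset.sum_comp H gap
    _ ≤ ∑ j ∈ P.image gap, (j : ℝ≥0∞) * H j := by
        refine Finset.sum_le_sum fun j _ => ?_
        rw [nsmul_eq_mul]
        gcongr
        exact hcard j
    _ ≤ _ := ENNReal.sum_le_tsum _

theorem tsum_maximalRects₁_le (hQ₁ : IsDyadicGrid A₁ Δ₁ v₁ u₁ Q₁)
    (hΔ₁ : IsUnitEllipsoid A₁ Δ₁) (hQ₂ : IsDyadicGrid A₂ Δ₂ v₂ u₂ Q₂)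
    (hΔ₂ : IsUnitEllipsoid A₂ Δ₂) {q : ℝ} (hq : 1 < q) {M : ℝ≥0}
    {f : EuclideanSpace ℝ (Fin n) × EuclideanSpace ℝ (Fin m) → ℝ≥0∞} (hfm : AEMeasurable f volume)
    (hf : ∀ᵐ y, HasMassBound (dyadicCubes Q₁) q M fun x => f (x, y))
    (hΩ : IsOpen Ω) {η : ℝ} (hη₀ : 0 < η) (hη₁ : η < 1)
    {lev : maximalRects₁ Q₁ Q₂ Ω → ℤ} (hlev : ∀ R, R.1.2 ∈ Q₂ (lev R))
    {gap : maximalRects₁ Q₁ Q₂ Ω → ℕ}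
    {J : maximalRects₁ Q₁ Q₂ Ω → Set (EuclideanSpace ℝ (Fin m))}
    (hJ : ∀ R, J R ∈ Q₂ (lev R - gap R)) (hRJ : ∀ R, R.1.2 ⊆ J R)
    (hJη : ∀ R, volume ((R.1.1 ×ˢ J R) ∩ Ω) ≤ ENNReal.ofReal η * volume (R.1.1 ×ˢ J R))
    (H : ℕ → ℝ≥0∞) :
    ∑' R : maximalRects₁ Q₁ Q₂ Ω, (∫⁻ z in R.1.1 ×ˢ R.1.2, f z) * H (gap R) ≤
      M / ENNReal.ofReal (1 - η) ^ q * (∑' j : ℕ, j * H j) * ∫⁻ z in Ω, f z := by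
  set M' := M / ENNReal.ofReal (1 - η) ^ q
  set D : maximalRects₁ Q₁ Q₂ Ω → Set (EuclideanSpace ℝ (Fin n) × EuclideanSpace ℝ (Fin m)) :=
    fun R => (R.1.1 \ dyadicBase Q₁ Ω (J R)) ×ˢ R.1.2
  have hD : ∀ R, MeasurableSet (D R) := by
    intro R
    obtain ⟨k, hk⟩ := mem_iUnion.1 R.2.1
    exact ((hQ₁.isOpen _ _ hk).measurableSet.diff (hQ₁.isOpen_dyadicBase _).measurableSet).prod
      (hQ₂.isOpen _ _ (hlev R)).measurableSet
  have hint : ∀ S : Set (EuclideanSpace ℝ (Fin n) × EuclideanSpace ℝ (Fin m)), MeasurableSet S →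
      ∫⁻ z in S, f z = ∫⁻ z, S.indicator 1 z * f z := by
    intro S hS
    rw [← lintegral_indicator hS]
    refine lintegral_congr fun z => ?_
    by_cases hz : z ∈ S <;> simp [hz]
  have hmeas : ∀ S : Set (EuclideanSpace ℝ (Fin n) × EuclideanSpace ℝ (Fin m)), MeasurableSet S →
      AEMeasurable (fun z => S.indicator 1 z * f z) volume := fun S hS =>
    ((measurable_one.indicator hS).aemeasurable).mul hfm
  -- Finite subsums suffice, so countability of the family of rectangles is never needed.
  refine ENNReal.summable.tsum_le_of_sum_le fun T => ?_
  calc ∑ R ∈ T, (∫⁻ z in R.1.1 ×ˢ R.1.2, f z) * H (gap R)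
      ≤ ∑ R ∈ T, M' * (∫⁻ z, H (gap R) * ((D R).indicator 1 z * f z)) := by
        refine Finset.sum_le_sum fun R _ => ?_
        obtain ⟨k, hk⟩ := mem_iUnion.1 R.2.1
        have h1 := lintegral_prod_le_lintegral_prod_diff hQ₁ hΔ₁ hq hfm hf hk hη₁
          (volume_le_volume_diff_dyadicBase hQ₁ (hQ₁.volume_ne_top hΔ₁ hk)
            (hQ₂.volume_ne_zero (hJ R)) (hQ₂.volume_ne_top hΔ₂ (hJ R)) hη₀ hη₁ (hJη R)) R.1.2
        rw [lintegral_const_mul'' _ (hmeas _ (hD R)), ← hint _ (hD R), mul_comm _ (H _),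
          mul_left_comm]
        gcongr
    _ = M' * ∫⁻ z, ∑ R ∈ T, H (gap R) * ((D R).indicator 1 z * f z) := by
        rw [lintegral_finsetSum' _ fun R _ => (hmeas _ (hD R)).const_mul _, Finset.mul_sum]
    _ ≤ M' * ∫⁻ z, (∑' j : ℕ, j * H j) * (Ω.indicator 1 z * f z) := by
        gcongr with z
        simp only [← mul_assoc]
        rw [← Finset.sum_mul]
        gcongr
        exact sum_indicator_diff_dyadicBase_le hQ₁ hQ₂ hlev hJ hRJ H T z
    _ = _ := by
        rw [lintegral_const_mul'' _ (hmeas _ hΩ.measurableSet), ← hint _ hΩ.measurableSet,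
          mul_assoc]

end Packing

/-! ### The covering lemma in each direction, and the exchange of factors. -/

section Journe

/-- The weights used in the covering lemma: almost every slice in either variable is a nontrivial
weight with Muckenhoupt constant at most `K`. -/
structure HasMuckenhouptSlices {n m : ℕ}
    (A₁ : Matrix (Fin n) (Fin n) ℝ) (Δ₁ : Set (EuclideanSpace ℝ (Fin n)))
    (A₂ : Matrix (Fin m) (Fin m) ℝ) (Δ₂ : Set (EuclideanSpace ℝ (Fin m))) (q : ℝ) (K : ℝ≥0)
    (w : EuclideanSpace ℝ (Fin n) × EuclideanSpace ℝ (Fin m) → ℝ) : Prop where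
  nonneg : ∀ z, 0 ≤ w z
  aemeasurable : AEMeasurable w volume
  slice₁ : ∀ᵐ x, AEMeasurable (fun y => w (x, y)) volume ∧ ¬ (fun y => w (x, y)) =ᵐ[volume] 0 ∧
    muckenhouptConst A₂ Δ₂ q (fun y => w (x, y)) ≤ K
  slice₂ : ∀ᵐ y, AEMeasurable (fun x => w (x, y)) volume ∧ ¬ (fun x => w (x, y)) =ᵐ[volume] 0 ∧
    muckenhouptConst A₁ Δ₁ q (fun x => w (x, y)) ≤ K

variable {n m : ℕ} {A₁ : Matrix (Fin n) (Fin n) ℝ} {Δ₁ : Set (EuclideanSpace ℝ (Fin n))}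
  {A₂ : Matrix (Fin m) (Fin m) ℝ} {Δ₂ : Set (EuclideanSpace ℝ (Fin m))}
  {v₁ v₂ : ℤ} {u₁ u₂ : ℕ} {Q₁ : ℤ → Set (Set (EuclideanSpace ℝ (Fin n)))}
  {Q₂ : ℤ → Set (Set (EuclideanSpace ℝ (Fin m)))}
  {Ω : Set (EuclideanSpace ℝ (Fin n) × EuclideanSpace ℝ (Fin m))}
  {q : ℝ} {K : ℝ≥0} {w : EuclideanSpace ℝ (Fin n) × EuclideanSpace ℝ (Fin m) → ℝ}

/-- Some `p < q` with `1 < p` is admissible; it supplies `1 < q` and the measurability and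
nontriviality of slices. The bound at `q` itself comes from `hK`, so monotonicity of the classes in
the exponent is not used. -/
theorem IsProductMuckenhouptInfty.hasMuckenhouptSlices
    (hw : IsProductMuckenhouptInfty A₁ Δ₁ A₂ Δ₂ w) (hq : criticalIndex A₁ Δ₁ A₂ Δ₂ w < q)
    (hK : productMuckenhouptConst A₁ Δ₁ A₂ Δ₂ q w ≤ K) :
    1 < q ∧ HasMuckenhouptSlices A₁ Δ₁ A₂ Δ₂ q K w := by
  obtain ⟨p, ⟨hp, hwp⟩, hpq⟩ := exists_lt_of_csInf_lt hw hq
  refine ⟨hp.trans hpq, hwp.nonneg, hwp.aemeasurable, ?_, ?_⟩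
  · filter_upwards [hwp.slice₁, ENNReal.ae_le_essSup
      (fun x₁ => muckenhouptConst A₂ Δ₂ q (fun x₂ => w (x₁, x₂)))] with x hx hxK
    exact ⟨hx.aemeasurable, hx.nontrivial, hxK.trans ((le_max_left _ _).trans hK)⟩
  · filter_upwards [hwp.slice₂, ENNReal.ae_le_essSup
      (fun x₂ => muckenhouptConst A₁ Δ₁ q (fun x₁ => w (x₁, x₂)))] with x hx hxK
    exact ⟨hx.aemeasurable, hx.nontrivial, hxK.trans ((le_max_right _ _).trans hK)⟩

theorem measurePreserving_prod_swap :
    MeasurePreserving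
      (Prod.swap : EuclideanSpace ℝ (Fin m) × EuclideanSpace ℝ (Fin n) → _) volume volume :=
  Measure.measurePreserving_swap

theorem HasMuckenhouptSlices.swap (hw : HasMuckenhouptSlices A₁ Δ₁ A₂ Δ₂ q K w) :
    HasMuckenhouptSlices A₂ Δ₂ A₁ Δ₁ q K (w ∘ Prod.swap) where
  nonneg z := hw.nonneg z.swap
  aemeasurable :=
    hw.aemeasurable.comp_quasiMeasurePreserving measurePreserving_prod_swap.quasiMeasurePreserving
  slice₁ := hw.slice₂
  slice₂ := hw.slice₁

theorem volumeRatio_le_one {S T : Set (EuclideanSpace ℝ (Fin n))} (h : S ⊆ T) :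
    volumeRatio S T ≤ 1 := by
  rw [volumeRatio]
  refine (ENNReal.toNNReal_mono ENNReal.one_ne_top ?_).trans_eq ENNReal.toNNReal_one
  exact ENNReal.div_le_of_le_mul (by simpa using measure_mono h)

/-- The volume ratio of a cube and its `k`-th ancestor, in the form in which it enters `h`. -/
theorem IsDyadicGrid.volumeRatio_ancestor_le (hQ₁ : IsDyadicGrid A₁ Δ₁ v₁ u₁ Q₁)
    (hΔ₁ : IsUnitEllipsoid A₁ Δ₁) (hb : 1 < dilationFactor A₁) (hv : v₁ < 0) (hu : 0 < u₁)
    {l : ℤ} {k : ℕ} {S T : Set (EuclideanSpace ℝ (Fin n))} (hS : S ∈ Q₁ l) (hT : T ∈ Q₁ (l - k))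
    (hST : S ⊆ T) {c δ : ℝ≥0} (hc : dilationFactor A₁ ^ (2 * (u₁ : ℤ) - 1) ≤ c)
    (hδ : dilationFactor A₁ ^ v₁ ≤ δ) : volumeRatio S T ≤ c * δ ^ (k - 1) := by
  -- For `k = 0` the truncated exponent leaves the bound `c`, which is at least one because `2 * u₁
  -- - 1 > 0`.
  rcases Nat.eq_zero_or_pos k with rfl | hk
  · have h1 : 1 ≤ c := (one_le_zpow₀ hb.le (by omega)).trans hc
    simpa using (volumeRatio_le_one hST).trans h1
  · have hb0 : dilationFactor A₁ ≠ 0 := by positivity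
    have hpow : dilationFactor A₁ ^ (2 * (u₁ : ℤ) + v₁ * k) ≤ c * δ ^ (k - 1) := by
      calc dilationFactor A₁ ^ (2 * (u₁ : ℤ) + v₁ * k)
          -- One factor `b ^ v₁` is traded for `b ^ (-1)`, as `v₁ ≤ -1`; this produces the exponent
          -- `2 * u₁ - 1`.
          ≤ dilationFactor A₁ ^ ((2 * (u₁ : ℤ) - 1) + v₁ * (k - 1 : ℕ)) := by
            refine zpow_le_zpow_right₀ hb.le ?_
            push_cast [Nat.cast_sub hk]
            linarith
        _ = dilationFactor A₁ ^ (2 * (u₁ : ℤ) - 1) * (dilationFactor A₁ ^ v₁) ^ (k - 1) := by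
            rw [zpow_add₀ hb0, zpow_mul, zpow_natCast]
        _ ≤ _ := by gcongr
    refine le_trans ?_ hpow
    rw [volumeRatio]
    refine (ENNReal.toNNReal_mono ENNReal.coe_ne_top (ENNReal.div_le_of_le_mul ?_)).trans_eq
      (ENNReal.toNNReal_coe _)
    calc volume S ≤ (dilationFactor A₁ ^ (v₁ * l + u₁) : ℝ≥0) := hQ₁.volume_le hΔ₁ hS
      _ = (dilationFactor A₁ ^ (2 * (u₁ : ℤ) + v₁ * k) : ℝ≥0) *
          (dilationFactor A₁ ^ (v₁ * (l - k) - u₁) : ℝ≥0) := by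
          rw [← ENNReal.coe_mul, ← zpow_add₀ hb0]
          congr 2
          ring
      _ ≤ _ := by
          gcongr
          exact hQ₁.le_volume hΔ₁ hT

theorem journe_maximalRects₁ (hΔ₁ : IsUnitEllipsoid A₁ Δ₁) (hΔ₂ : IsUnitEllipsoid A₂ Δ₂)
    (hb₁ : 1 < dilationFactor A₁) (hb₂ : 1 < dilationFactor A₂) (hv₂ : v₂ < 0) (hu₂ : 0 < u₂)
    (hQ₁ : IsDyadicGrid A₁ Δ₁ v₁ u₁ Q₁) (hQ₂ : IsDyadicGrid A₂ Δ₂ v₂ u₂ Q₂) {η : ℝ} (hη₀ : 0 < η)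
    (hη₁ : η < 1) {h : ℝ≥0 → ℝ≥0} (h_mono : Monotone h) {c δ : ℝ≥0}
    (hc : dilationFactor A₂ ^ (2 * (u₂ : ℤ) - 1) ≤ c) (hδ : dilationFactor A₂ ^ v₂ ≤ δ)
    (hq : 1 < q) (hw : HasMuckenhouptSlices A₁ Δ₁ A₂ Δ₂ q K w) (hΩ : IsOpen Ω)
    (hwΩ : weightOf w Ω < ∞) :
    (∀ R ∈ maximalRects₁ Q₁ Q₂ Ω,
        IsGreatest (enlargements₂ Q₂ η Ω R) (longest (enlargements₂ Q₂ η Ω R))) ∧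
      ∑' R : maximalRects₁ Q₁ Q₂ Ω, weightOf w (R.1.1 ×ˢ R.1.2) *
          (h (volumeRatio R.1.2 (longest (enlargements₂ Q₂ η Ω R.1))) : ℝ≥0∞)
        ≤ cubeMassConst A₁ u₁ q K / ENNReal.ofReal (1 - η) ^ q *
          (∑' j : ℕ, (j : ℝ≥0∞) * (h (c * δ ^ (j - 2)) : ℝ≥0∞)) * weightOf w Ω := by
  have hfm : AEMeasurable (fun z => ENNReal.ofReal (w z)) volume := hw.aemeasurable.ennreal_ofReal
  have key : ∀ R : maximalRects₁ Q₁ Q₂ Ω, ∃ (l : ℤ) (k : ℕ)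
      (T J : Set (EuclideanSpace ℝ (Fin m))), R.1.2 ∈ Q₂ l ∧
      T ∈ Q₂ (l - k) ∧ R.1.2 ⊆ T ∧ IsGreatest (enlargements₂ Q₂ η Ω R.1) T ∧
      J ∈ Q₂ (l - (k + 1 : ℕ)) ∧ R.1.2 ⊆ J ∧
      volume ((R.1.1 ×ˢ J) ∩ Ω) ≤ ENNReal.ofReal η * volume (R.1.1 ×ˢ J) := by
    rintro ⟨⟨S, I⟩, hS, hI, hsub, -⟩
    obtain ⟨j, hS⟩ := mem_iUnion.1 hS
    obtain ⟨l, hI⟩ := mem_iUnion.1 hI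
    obtain ⟨a, rfl, ha, hmono⟩ := hQ₂.exists_ancestors hI
    obtain ⟨k, hk, hk'⟩ := hQ₂.exists_isGreatest_enlargements hΔ₂ hb₂ hv₂ ha hmono hq hfm
      (M := cubeMassConst A₂ u₂ q K)
      (by
        filter_upwards [hw.slice₁] with x hx
        exact hQ₂.hasMassBound hΔ₂ hb₂ hq hx.1 hx.2.2)
      (by
        filter_upwards [hw.slice₁] with x hx
        exact hQ₂.lintegral_pos hΔ₂ hb₂ hq hx.1 (fun y => hw.nonneg (x, y)) hx.2.1 hx.2.2 hI)
      hΩ.measurableSet hwΩ.ne (hQ₁.isOpen _ _ hS).measurableSet (hQ₁.volume_ne_zero hS)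
      (hQ₁.volume_ne_top hΔ₁ hS) hsub hη₀ hη₁
    refine ⟨l, k, a k, a (k + 1), hI, ha k, hmono (Nat.zero_le _), hk, ha _,
      hmono (Nat.zero_le _), ?_⟩
    by_contra! hlt
    exact hk' ⟨mem_iUnion.2 ⟨_, ha (k + 1)⟩, hmono (Nat.zero_le _), hlt⟩
  choose lev k T J hlev hT hRT hgr hJ hRJ hJη using key
  refine ⟨fun R hR => ?_, ?_⟩
  · rw [longest_eq_of_isGreatest (hgr ⟨R, hR⟩)]
    exact hgr ⟨R, hR⟩
  · refine le_trans ?_ (tsum_maximalRects₁_le hQ₁ hΔ₁ hQ₂ hΔ₂ hq hfm ?_ hΩ hη₀ hη₁ hlev hJ hRJ hJη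
      -- The gap is `j = k + 1`, one beyond the largest enlargement, so the exponent `k - 1` of the
      -- volume ratio bound reads `j - 2`.
      fun j => (h (c * δ ^ (j - 2)) : ℝ≥0∞))
    · refine ENNReal.tsum_le_tsum fun R => ?_
      rw [longest_eq_of_isGreatest (hgr R)]
      refine mul_le_mul_right (ENNReal.coe_le_coe.2 (h_mono ?_)) _
      have := hQ₂.volumeRatio_ancestor_le hΔ₂ hb₂ hv₂ hu₂ (hlev R) (hT R) (hRT R) hc hδ
      simpa using this
    · filter_upwards [hw.slice₂] with y hy
      exact hQ₁.hasMassBound hΔ₁ hb₁ hq hy.1 hy.2.2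

theorem weightOf_swap (w : EuclideanSpace ℝ (Fin n) × EuclideanSpace ℝ (Fin m) → ℝ)
    (E : Set (EuclideanSpace ℝ (Fin n) × EuclideanSpace ℝ (Fin m))) :
    weightOf (w ∘ Prod.swap) (Prod.swap ⁻¹' E) = weightOf w E :=
  measurePreserving_prod_swap.setLIntegral_comp_preimage_emb
    MeasurableEquiv.prodComm.measurableEmbedding (fun z => ENNReal.ofReal (w z)) E

theorem volume_preimage_swap
    (E : Set (EuclideanSpace ℝ (Fin n) × EuclideanSpace ℝ (Fin m))) :
    volume (Prod.swap ⁻¹' E) = volume E :=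
  measurePreserving_prod_swap.measure_preimage_emb
    MeasurableEquiv.prodComm.measurableEmbedding E

theorem prod_subset_preimage_swap {S : Set (EuclideanSpace ℝ (Fin n))}
    {T : Set (EuclideanSpace ℝ (Fin m))} :
    T ×ˢ S ⊆ Prod.swap ⁻¹' Ω ↔ S ×ˢ T ⊆ Ω :=
  ⟨fun h z hz => h (show z.swap ∈ T ×ˢ S from ⟨hz.2, hz.1⟩), fun h _ hz => h ⟨hz.2, hz.1⟩⟩

theorem enlargements₂_swap {η : ℝ}
    (R : Set (EuclideanSpace ℝ (Fin n)) × Set (EuclideanSpace ℝ (Fin m))) :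
    enlargements₂ Q₁ η (Prod.swap ⁻¹' Ω) R.swap = enlargements₁ Q₁ η Ω R := by
  ext S
  have h1 : volume (R.2 ×ˢ S) = volume (S ×ˢ R.2) := by
    rw [← preimage_swap_prod, volume_preimage_swap]
  have h2 : volume ((R.2 ×ˢ S) ∩ Prod.swap ⁻¹' Ω) = volume ((S ×ˢ R.2) ∩ Ω) := by
    rw [← preimage_swap_prod, ← preimage_inter, volume_preimage_swap]
  change S ∈ dyadicCubes Q₁ ∧ R.1 ⊆ S ∧ ENNReal.ofReal η * volume (R.2 ×ˢ S) <
    volume ((R.2 ×ˢ S) ∩ Prod.swap ⁻¹' Ω) ↔ _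
  rw [h1, h2]
  rfl

theorem mem_maximalRects₁_swap
    {R : Set (EuclideanSpace ℝ (Fin n)) × Set (EuclideanSpace ℝ (Fin m))} :
    R.swap ∈ maximalRects₁ Q₂ Q₁ (Prod.swap ⁻¹' Ω) ↔ R ∈ maximalRects₂ Q₁ Q₂ Ω := by
  change (R.2 ∈ dyadicCubes Q₂ ∧ R.1 ∈ dyadicCubes Q₁ ∧ R.2 ×ˢ R.1 ⊆ Prod.swap ⁻¹' Ω ∧
    ∀ S ∈ dyadicCubes Q₂, R.2 ⊆ S → S ×ˢ R.1 ⊆ Prod.swap ⁻¹' Ω → S = R.2) ↔ _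
  simp only [prod_subset_preimage_swap]
  exact ⟨fun h => ⟨h.2.1, h.1, h.2.2⟩, fun h => ⟨h.2.1, h.1, h.2.2⟩⟩

theorem journe_maximalRects₂ (hΔ₁ : IsUnitEllipsoid A₁ Δ₁) (hΔ₂ : IsUnitEllipsoid A₂ Δ₂)
    (hb₁ : 1 < dilationFactor A₁) (hb₂ : 1 < dilationFactor A₂) (hv₁ : v₁ < 0) (hu₁ : 0 < u₁)
    (hQ₁ : IsDyadicGrid A₁ Δ₁ v₁ u₁ Q₁) (hQ₂ : IsDyadicGrid A₂ Δ₂ v₂ u₂ Q₂) {η : ℝ} (hη₀ : 0 < η)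
    (hη₁ : η < 1) {h : ℝ≥0 → ℝ≥0} (h_mono : Monotone h) {c δ : ℝ≥0}
    (hc : dilationFactor A₁ ^ (2 * (u₁ : ℤ) - 1) ≤ c) (hδ : dilationFactor A₁ ^ v₁ ≤ δ)
    (hq : 1 < q) (hw : HasMuckenhouptSlices A₁ Δ₁ A₂ Δ₂ q K w) (hΩ : IsOpen Ω)
    (hwΩ : weightOf w Ω < ∞) :
    (∀ R ∈ maximalRects₂ Q₁ Q₂ Ω,
        IsGreatest (enlargements₁ Q₁ η Ω R) (longest (enlargements₁ Q₁ η Ω R))) ∧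
      ∑' R : maximalRects₂ Q₁ Q₂ Ω, weightOf w (R.1.1 ×ˢ R.1.2) *
          (h (volumeRatio R.1.1 (longest (enlargements₁ Q₁ η Ω R.1))) : ℝ≥0∞)
        ≤ cubeMassConst A₂ u₂ q K / ENNReal.ofReal (1 - η) ^ q *
          (∑' j : ℕ, (j : ℝ≥0∞) * (h (c * δ ^ (j - 2)) : ℝ≥0∞)) * weightOf w Ω := by
  obtain ⟨hgr, hsum⟩ := journe_maximalRects₁ hΔ₂ hΔ₁ hb₂ hb₁ hv₁ hu₁ hQ₂ hQ₁ hη₀ hη₁ h_mono hc hδ hq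
    hw.swap (hΩ.preimage continuous_swap) (by rwa [weightOf_swap])
  refine ⟨fun R hR => ?_, ?_⟩
  · have := hgr R.swap (mem_maximalRects₁_swap.2 hR)
    rwa [enlargements₂_swap] at this
  · rw [weightOf_swap] at hsum
    refine le_trans (le_of_eq ?_) hsum
    let e : maximalRects₂ Q₁ Q₂ Ω ≃ maximalRects₁ Q₂ Q₁ (Prod.swap ⁻¹' Ω) :=
      (Equiv.prodComm _ _).subtypeEquiv fun _ => mem_maximalRects₁_swap.symm
    rw [← e.tsum_eq]
    refine tsum_congr fun R => ?_
    have he : (e R).1 = R.1.swap := rfl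
    rw [he, enlargements₂_swap, Prod.fst_swap, Prod.snd_swap, ← preimage_swap_prod R.1.1,
      weightOf_swap]

theorem tsum_mul_shift_ne_top {g : ℕ → ℝ≥0} (hg : Summable fun j : ℕ => (j : ℝ≥0) * g j) :
    ∑' j : ℕ, (j : ℝ≥0∞) * (g (j - 2) : ℝ≥0∞) ≠ ∞ := by
  -- Past the term `j = 0`, the coefficient `j + 2` is at most `3 * j`.
  have h1 : Summable fun j : ℕ => ((j + 2 : ℕ) : ℝ≥0) * g j := by
    rw [← NNReal.summable_nat_add_iff 1]
    refine NNReal.summable_of_le (fun j => ?_) (((NNReal.summable_nat_add_iff 1).2 hg).mul_left 3)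
    rw [← mul_assoc]
    gcongr
    push_cast
    nlinarith [zero_le (a := (j : ℝ≥0))]
  have h2 : Summable fun j : ℕ => (j : ℝ≥0) * g (j - 2) := by
    rw [← NNReal.summable_nat_add_iff 2]
    simpa using h1
  have := ENNReal.tsum_coe_ne_top_iff_summable.2 h2
  simpa using this

end Journe

theorem lemma4p4 (n m : ℕ) (hn : 1 ≤ n) (hm : 1 ≤ m)
    (A₁ : Matrix (Fin n) (Fin n) ℝ) (A₂ : Matrix (Fin m) (Fin m) ℝ)
    (hA₁ : IsExpansiveDilation A₁) (hA₂ : IsExpansiveDilation A₂)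
    (Δ₁ : Set (EuclideanSpace ℝ (Fin n))) (Δ₂ : Set (EuclideanSpace ℝ (Fin m)))
    (hΔ₁ : IsUnitEllipsoid A₁ Δ₁) (hΔ₂ : IsUnitEllipsoid A₂ Δ₂)
    (v₁ v₂ : ℤ) (hv₁ : v₁ < 0) (hv₂ : v₂ < 0) (u₁ u₂ : ℕ) (hu₁ : 0 < u₁) (hu₂ : 0 < u₂)
    (η : ℝ) (hη₀ : 0 < η) (hη₁ : η < 1)
    (h : ℝ≥0 → ℝ≥0) (h_mono : Monotone h)
    (h_sum : Summable fun j : ℕ => (j : ℝ≥0) *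
      h (max (dilationFactor A₁ ^ (2 * (u₁ : ℤ) - 1)) (dilationFactor A₂ ^ (2 * (u₂ : ℤ) - 1)) *
        max (dilationFactor A₁ ^ v₁) (dilationFactor A₂ ^ v₂) ^ j))
    (q : ℝ) (K : ℝ≥0) :
    ∃ C : ℝ≥0, 0 < C ∧
      ∀ (Q₁ : ℤ → Set (Set (EuclideanSpace ℝ (Fin n))))
        (Q₂ : ℤ → Set (Set (EuclideanSpace ℝ (Fin m)))),
        IsDyadicGrid A₁ Δ₁ v₁ u₁ Q₁ → IsDyadicGrid A₂ Δ₂ v₂ u₂ Q₂ →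
      ∀ w : EuclideanSpace ℝ (Fin n) × EuclideanSpace ℝ (Fin m) → ℝ,
        IsProductMuckenhouptInfty A₁ Δ₁ A₂ Δ₂ w →
        criticalIndex A₁ Δ₁ A₂ Δ₂ w < q →
        productMuckenhouptConst A₁ Δ₁ A₂ Δ₂ q w ≤ (K : ℝ≥0∞) →
      ∀ Ω : Set (EuclideanSpace ℝ (Fin n) × EuclideanSpace ℝ (Fin m)),
        IsOpen Ω → weightOf w Ω < ∞ →
        ((∀ R ∈ maximalRects₁ Q₁ Q₂ Ω,
            IsGreatest (enlargements₂ Q₂ η Ω R) (longest (enlargements₂ Q₂ η Ω R))) ∧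
          ∑' R : maximalRects₁ Q₁ Q₂ Ω, weightOf w (R.1.1 ×ˢ R.1.2) *
              (h (volumeRatio R.1.2 (longest (enlargements₂ Q₂ η Ω R.1))) : ℝ≥0∞)
            ≤ (C : ℝ≥0∞) * weightOf w Ω) ∧
        ((∀ R ∈ maximalRects₂ Q₁ Q₂ Ω,
            IsGreatest (enlargements₁ Q₁ η Ω R) (longest (enlargements₁ Q₁ η Ω R))) ∧
          ∑' R : maximalRects₂ Q₁ Q₂ Ω, weightOf w (R.1.1 ×ˢ R.1.2) *
              (h (volumeRatio R.1.1 (longest (enlargements₁ Q₁ η Ω R.1))) : ℝ≥0∞)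
            ≤ (C : ℝ≥0∞) * weightOf w Ω) := by
  have hb₁ := hΔ₁.one_lt_dilationFactor hn
  have hb₂ := hΔ₂.one_lt_dilationFactor hm
  by_cases hq : 1 < q
  swap
  -- For `q ≤ 1` no weight qualifies: a critical index below `q` forces `1 < q`.
  · refine ⟨1, one_pos, fun Q₁ Q₂ hQ₁ hQ₂ w hw hwq hwK => ?_⟩
    exact absurd (hw.hasMuckenhouptSlices hwq hwK).1 hq
  set c := max (dilationFactor A₁ ^ (2 * (u₁ : ℤ) - 1)) (dilationFactor A₂ ^ (2 * (u₂ : ℤ) - 1))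
  set δ := max (dilationFactor A₁ ^ v₁) (dilationFactor A₂ ^ v₂)
  set s := ∑' j : ℕ, (j : ℝ≥0∞) * (h (c * δ ^ (j - 2)) : ℝ≥0∞)
  have hs_fin : s ≠ ∞ := tsum_mul_shift_ne_top h_sum
  have hη : ENNReal.ofReal (1 - η) ^ q ≠ 0 := by
    simpa [ENNReal.rpow_eq_zero_iff] using fun h' => absurd h' (not_le.2 hη₁)
  have hfin : ∀ M : ℝ≥0, (M : ℝ≥0∞) / ENNReal.ofReal (1 - η) ^ q * s ≠ ∞ := fun M =>
    ENNReal.mul_ne_top (ENNReal.div_ne_top ENNReal.coe_ne_top hη) hs_fin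
  set C₁ := (cubeMassConst A₁ u₁ q K : ℝ≥0∞) / ENNReal.ofReal (1 - η) ^ q * s
  set C₂ := (cubeMassConst A₂ u₂ q K : ℝ≥0∞) / ENNReal.ofReal (1 - η) ^ q * s
  have hC₁ : C₁ ≤ ((C₁.toNNReal + C₂.toNNReal + 1 : ℝ≥0) : ℝ≥0∞) := by
    refine (ENNReal.coe_toNNReal (hfin _ : C₁ ≠ ∞)).ge.trans (ENNReal.coe_le_coe.2 ?_)
    rw [add_assoc]
    exact le_self_add
  have hC₂ : C₂ ≤ ((C₁.toNNReal + C₂.toNNReal + 1 : ℝ≥0) : ℝ≥0∞) := by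
    refine (ENNReal.coe_toNNReal (hfin _ : C₂ ≠ ∞)).ge.trans (ENNReal.coe_le_coe.2 ?_)
    rw [add_right_comm]
    exact le_add_self
  -- One constant for both directions; the summand `1` only ensures positivity.
  refine ⟨C₁.toNNReal + C₂.toNNReal + 1, by positivity, ?_⟩
  intro Q₁ Q₂ hQ₁ hQ₂ w hw hwq hwK Ω hΩ hwΩ
  have hws := (hw.hasMuckenhouptSlices hwq hwK).2
  obtain ⟨hgr₁, hsum₁⟩ := journe_maximalRects₁ hΔ₁ hΔ₂ hb₁ hb₂ hv₂ hu₂ hQ₁ hQ₂ hη₀ hη₁ h_mono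
    (le_max_right _ _ : _ ≤ c) (le_max_right _ _ : _ ≤ δ) hq hws hΩ hwΩ
  obtain ⟨hgr₂, hsum₂⟩ := journe_maximalRects₂ hΔ₁ hΔ₂ hb₁ hb₂ hv₁ hu₁ hQ₁ hQ₂ hη₀ hη₁ h_mono
    (le_max_left _ _ : _ ≤ c) (le_max_left _ _ : _ ≤ δ) hq hws hΩ hwΩ
  exact ⟨⟨hgr₁, hsum₁.trans (mul_le_mul_left hC₁ _)⟩, ⟨hgr₂, hsum₂.trans (mul_le_mul_left hC₂ _)⟩⟩
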